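/- Let $G$ be an abelian group, written additively. A zero-sum sequence over $G$ is a finite unordered sequence of elements of $G$ (repetition allowed) whose sum is $0$; these sequences form a commutative monoid $\mathcal B(G)$ under concatenation, a submonoid of the free abelian monoid with basis $G$. An atom of $\mathcal B(G)$ is a minimal zero-sum sequence, that is, a non-empty zero-sum sequence that is not the concatenation of two non-empty zero-sum sequences. For $S \in \mathcal B(G)$ let $$\mathsf L(S) = \{ k \in \mathbb N_0 \mid S = U_1 \cdot \ldots \cdot U_k \text{ for some atoms } U_1, \ldots, U_k \text{ of } \mathcal B(G) \}$$ be its set of lengths (so that $\mathsf L(S)=\{0\}$ for the empty sequence $S$), and let $\mathcal L(G) = \{ \mathsf L(S) \mid S \in \mathcal B(G)\}$ be the system of sets of lengths of $G$. Write $C_m$ for a cyclic group of order $m$. **Corollary 1.3.** Let $G$ be an abelian group (finite or infinite). 1. If $\mathcal L(G) = \mathcal L(C_2^{r-1} \oplus C_4)$ for some integer $r \ge 2$, then $G \cong C_2^{r-1} \oplus C_4$. 2. If $\mathcal L(G) = \mathcal L(C_2 \oplus C_{2n})$ for some integer $n \ge 2$, then $G \cong C_2 \oplus C_{2n}$. 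-/

import Mathlib

namespace SetsOfLengths

section Monoids

variable {H : Type*} [CommMonoid H]

/-- The factorizations of `a ∈ H`: the formal products (multisets) of atoms of the reduced monoid
`H_red = H / Hˣ` (which is `Associates H`) whose product in `H_red` is the class of `a`. -/
def factorizations (a : H) : Set (Multiset (Associates H)) :=
  {z | (∀ u ∈ z, Irreducible u) ∧ z.prod = Associates.mk a}

/-- The set of lengths `L(a)`: the numbers of atoms, counted with multiplicity, in the
factorizations of `a`. -/
def lengths (a : H) : Set ℕ :=
  {k | ∃ z ∈ factorizations a, Multiset.card z = k}

end Monoids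

/-- The system of sets of lengths `{L(a) | a ∈ H}` of a commutative monoid `H`. -/
def lengthSystem (H : Type*) [CommMonoid H] : Set (Set ℕ) :=
  Set.range (lengths : H → Set ℕ)

/-- The monoid `B(G)` of zero-sum sequences over `G`, a submonoid of the free abelian monoid with
basis `G`, which is the monoid of finite multisets of elements of `G`, written multiplicatively. -/
def zeroSumSequences (G : Type*) [AddCommGroup G] : Submonoid (Multiplicative (Multiset G)) where
  carrier := {S | S.toAdd.sum = 0}
  one_mem' := by simp
  mul_mem' := by
    intro S T hS hT
    change S.toAdd.sum = 0 at hS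
    change T.toAdd.sum = 0 at hT
    change (S * T).toAdd.sum = 0
    rw [toAdd_mul, Multiset.sum_add, hS, hT, add_zero]

/-- The system of sets of lengths of an abelian group `G`, that is, of the monoid `B(G)`. -/
def groupLengthSystem (G : Type*) [AddCommGroup G] : Set (Set ℕ) :=
  lengthSystem (zeroSumSequences G)

end SetsOfLengths

/-
Over `C₂ᵇ ⊕ C_m` with `b ≥ 1` and `m ≥ 3` there is a minimal zero-sum sequence `U` of length `b + m`
with `L(U(-U)) = {2, m, b + m}`. If `2 ∈ L(S)`, then `S` is a product of two minimal zero-sum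
sequences, so, if the Davenport constant is `D ≥ 3`, every length of `S` is at most `D`, with
equality only if `S = U(-U)` with a minimal zero-sum sequence `U` of length `D`. An upper bound for
the Davenport constant therefore passes from one group to another with the same system of sets of
lengths, and so does the set `{2, m, b + m}`: it is `L(U(-U))` for a longest minimal zero-sum
sequence `U` over `G`.

Since `U` is as long as possible, every element of `G` is the sum of a subsequence of `U` avoiding
any prescribed term, which produces many pairs of disjoint subsequences `A`, `B` of `U` with the
same sum. Factoring `A(-B)` and `B(-A)` and pairing the remaining terms with their negatives gives a
length of `U(-U)`, so the few lengths allowed restrict `|A| + |B|` severely. For `{2, 2n, 2n + 1}`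
this forces `U = g²ⁿ⁻¹ (g + e) e` with `2e = 0`; for `{2, 4, b + 4}` with `b ≥ 2` it forces `2x` to
take a single non-zero value on `G`. Either way the group can be read off.
-/

namespace SetsOfLengths

section Factorizations

variable {G : Type*} [AddCommGroup G]

/-- A minimal zero-sum sequence over `G`, that is, an atom of `B(G)`, as a multiset. -/
structure IsMinZeroSum (U : Multiset G) : Prop where
  ne_zero : U ≠ 0
  sum_eq_zero : U.sum = 0
  eq_of_le : ∀ ⦃T⦄, T ≤ U → T.sum = 0 → T ≠ 0 → T = U

/-- `z` is a factorization of the sequence `S` into minimal zero-sum sequences. -/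
structure IsFactorization (z : Multiset (Multiset G)) (S : Multiset G) : Prop where
  isMinZeroSum : ∀ W ∈ z, IsMinZeroSum W
  sum_eq : z.sum = S

/-- The set of lengths of the sequence `S`, in terms of multisets. For zero-sum sequences this is
`lengths`, see `lengths_eq_lengthSet`. -/
def lengthSet (S : Multiset G) : Set ℕ :=
  {k | ∃ z, IsFactorization z S ∧ z.card = k}

lemma toAdd_eq_zero_iff (a : zeroSumSequences G) : a.1.toAdd = 0 ↔ a = 1 :=
  ⟨fun h ↦ Subtype.ext (Multiplicative.toAdd.injective h), by rintro rfl; rfl⟩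

lemma isUnit_zeroSumSequences_iff (a : zeroSumSequences G) : IsUnit a ↔ a.1.toAdd = 0 := by
  refine ⟨fun h ↦ ?_, fun h ↦ (toAdd_eq_zero_iff a).mp h ▸ isUnit_one⟩
  obtain ⟨b, hb⟩ := h.exists_right_inv
  have hab : a.1.toAdd + b.1.toAdd = 0 := congrArg (fun x : zeroSumSequences G ↦ x.1.toAdd) hb
  exact (add_eq_zero.mp hab).1

instance : Subsingleton (zeroSumSequences G)ˣ where
  allEq u v := by
    have eq_one (w : (zeroSumSequences G)ˣ) : (w : zeroSumSequences G) = 1 :=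
      (toAdd_eq_zero_iff _).mp ((isUnit_zeroSumSequences_iff _).mp w.isUnit)
    exact Units.ext ((eq_one u).trans (eq_one v).symm)

lemma irreducible_iff_isMinZeroSum (a : zeroSumSequences G) :
    Irreducible a ↔ IsMinZeroSum a.1.toAdd := by
  simp only [irreducible_iff, isUnit_zeroSumSequences_iff]
  refine ⟨fun ⟨ha, hsplit⟩ ↦ ⟨ha, a.2, fun T hT hT0 hne ↦ ?_⟩, fun h ↦ ⟨h.ne_zero, ?_⟩⟩
  · obtain ⟨R, hR⟩ := Multiset.le_iff_exists_add.mp hT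
    have hR0 : R.sum = 0 := by
      have ha0 : a.1.toAdd.sum = 0 := a.2
      rwa [hR, Multiset.sum_add, hT0, zero_add] at ha0
    have hT' : T = 0 ∨ R = 0 :=
      @hsplit ⟨Multiplicative.ofAdd T, hT0⟩ ⟨Multiplicative.ofAdd R, hR0⟩
        (Subtype.ext (Multiplicative.toAdd.injective hR))
    rw [hR, hT'.resolve_left hne, add_zero]
  · rintro b c rfl
    have hbc : (b * c).1.toAdd = b.1.toAdd + c.1.toAdd := rfl
    by_cases hb : b.1.toAdd = 0
    · exact .inl hb
    · have := h.eq_of_le (hbc ▸ Multiset.le_add_right _ _) b.2 hb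
      exact .inr (by simpa [hbc] using this)

lemma toAdd_prod (z : Multiset (zeroSumSequences G)) :
    z.prod.1.toAdd = (z.map fun b ↦ b.1.toAdd).sum := by
  induction z using Multiset.induction_on with
  | empty => rfl
  | cons a s ih => rw [Multiset.prod_cons, Multiset.map_cons, Multiset.sum_cons, ← ih]; rfl

lemma isFactorization_map_toAdd_iff (a : zeroSumSequences G) (y : Multiset (zeroSumSequences G)) :
    IsFactorization (y.map fun b ↦ b.1.toAdd) a.1.toAdd ↔
      y.map Associates.mk ∈ factorizations a := by
  have hirr (b : zeroSumSequences G) : Irreducible (Associates.mk b) ↔ Irreducible b :=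
    MulEquiv.irreducible_iff (MulEquiv.ofBijective Associates.mkMonoidHom
      ⟨Associates.mk_injective, Associates.mk_surjective⟩) (x := b)
  have hprod : (y.map fun b ↦ b.1.toAdd).sum = a.1.toAdd ↔
      (y.map Associates.mk).prod = Associates.mk a := by
    rw [← toAdd_prod, Associates.prod_mk, Associates.mk_injective.eq_iff,
      Multiplicative.toAdd.injective.eq_iff, Subtype.val_injective.eq_iff]
  have hatoms : (∀ W ∈ y.map fun b ↦ b.1.toAdd, IsMinZeroSum W) ↔
      ∀ u ∈ y.map Associates.mk, Irreducible u := by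
    simp only [Multiset.forall_mem_map_iff, hirr, irreducible_iff_isMinZeroSum]
  exact ⟨fun h ↦ ⟨hatoms.mp h.isMinZeroSum, hprod.mp h.sum_eq⟩,
    fun h ↦ ⟨hatoms.mpr h.1, hprod.mpr h.2⟩⟩

lemma lengths_eq_lengthSet (a : zeroSumSequences G) : lengths a = lengthSet a.1.toAdd := by
  ext k
  constructor
  · rintro ⟨z, hz, rfl⟩
    obtain ⟨y, rfl⟩ := Multiset.map_surjective_of_surjective Associates.mk_surjective z
    exact ⟨_, (isFactorization_map_toAdd_iff a y).mpr hz, by simp⟩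
  · rintro ⟨z, hz, rfl⟩
    have : CanLift (Multiset G) (zeroSumSequences G) (fun b ↦ b.1.toAdd) (fun W ↦ W.sum = 0) :=
      ⟨fun W hW ↦ ⟨⟨Multiplicative.ofAdd W, hW⟩, rfl⟩⟩
    lift z to Multiset (zeroSumSequences G) using fun W hW ↦ (hz.isMinZeroSum W hW).sum_eq_zero
    exact ⟨_, (isFactorization_map_toAdd_iff a z).mp hz, by simp⟩

lemma mem_groupLengthSystem_iff (L : Set ℕ) :
    L ∈ groupLengthSystem G ↔ ∃ S : Multiset G, S.sum = 0 ∧ lengthSet S = L := by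
  constructor
  · rintro ⟨a, rfl⟩
    exact ⟨a.1.toAdd, a.2, (lengths_eq_lengthSet a).symm⟩
  · rintro ⟨S, hS, rfl⟩
    exact ⟨⟨Multiplicative.ofAdd S, hS⟩, lengths_eq_lengthSet _⟩

section Map

variable {H : Type*} [AddCommGroup H]

lemma IsMinZeroSum.map (e : G ≃+ H) {U : Multiset G} (hU : IsMinZeroSum U) :
    IsMinZeroSum (U.map e) where
  ne_zero := by simpa using hU.ne_zero
  sum_eq_zero := by rw [← map_multiset_sum, hU.sum_eq_zero, map_zero]
  eq_of_le T hT hT0 hne := by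
    have hle : T.map e.symm ≤ U := by
      simpa [Multiset.map_map, Function.comp_def] using Multiset.map_le_map (f := e.symm) hT
    rw [← hU.eq_of_le hle (by rw [← map_multiset_sum, hT0, map_zero]) (by simpa using hne)]
    simp [Multiset.map_map]

lemma IsFactorization.map (e : G ≃+ H) {z : Multiset (Multiset G)} {S : Multiset G}
    (hz : IsFactorization z S) : IsFactorization (z.map (Multiset.map e)) (S.map e) where
  isMinZeroSum W hW := by
    obtain ⟨V, hV, rfl⟩ := Multiset.mem_map.mp hW
    exact (hz.isMinZeroSum V hV).map e
  sum_eq := by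
    rw [← hz.sum_eq]
    exact (map_multiset_sum (Multiset.mapAddMonoidHom e) z).symm

lemma lengthSet_map (e : G ≃+ H) (S : Multiset G) : lengthSet (S.map e) = lengthSet S := by
  ext k
  constructor
  · rintro ⟨z, hz, rfl⟩
    have := hz.map e.symm
    rw [Multiset.map_map, show e.symm ∘ e = id from funext e.symm_apply_apply,
      Multiset.map_id] at this
    exact ⟨_, this, by simp⟩
  · rintro ⟨z, hz, rfl⟩
    exact ⟨_, hz.map e, by simp⟩

lemma groupLengthSystem_subset_of_addEquiv (e : G ≃+ H) :
    groupLengthSystem G ⊆ groupLengthSystem H := by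
  intro L hL
  obtain ⟨S, hS, rfl⟩ := (mem_groupLengthSystem_iff L).mp hL
  exact (mem_groupLengthSystem_iff _).mpr
    ⟨S.map e, by rw [← map_multiset_sum, hS, map_zero], lengthSet_map e S⟩

lemma groupLengthSystem_congr (e : G ≃+ H) : groupLengthSystem G = groupLengthSystem H :=
  (groupLengthSystem_subset_of_addEquiv e).antisymm (groupLengthSystem_subset_of_addEquiv e.symm)

end Map

end Factorizations


section Multiset

variable {α : Type*}

lemma exists_add_eq_of_le_add {W A B : Multiset α} (h : W ≤ A + B) :
    ∃ A' ≤ A, ∃ B' ≤ B, A' + B' = W := by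
  classical
  refine ⟨W ∩ A, Multiset.inter_le_right, W - A, ?_, ?_⟩
  · rw [Multiset.sub_le_iff_le_add, add_comm]
    exact h
  · ext x
    simp only [Multiset.count_add, Multiset.count_inter, Multiset.count_sub]
    omega

lemma add_le_of_disjoint {U A B : Multiset α} (hA : A ≤ U) (hB : B ≤ U) (hd : Disjoint A B) :
    A + B ≤ U := by
  classical
  rw [Multiset.add_eq_union_iff_disjoint.mpr hd]
  exact Multiset.union_le hA hB

lemma pair_le_of_ne {U : Multiset α} {g h : α} (hgh : g ≠ h) (hg : g ∈ U) (hh : h ∈ U) :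
    {g, h} ≤ U :=
  (Multiset.cons_le_of_notMem (by simpa using hgh)).mpr ⟨hg, by simpa using hh⟩

lemma le_multiset_sum_of_mem {z : Multiset (Multiset α)} {W : Multiset α} (hW : W ∈ z) :
    W ≤ z.sum := by
  obtain ⟨t, rfl⟩ := Multiset.exists_cons_of_mem hW
  simp

lemma mul_card_le_card_sum {z : Multiset (Multiset α)} {n : ℕ} (h : ∀ W ∈ z, n ≤ W.card) :
    n * z.card ≤ z.sum.card := by
  have := Multiset.card_nsmul_le_sum (s := z.map Multiset.card) (a := n) (by simpa using h)
  rw [← Multiset.join, Multiset.card_join]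
  simpa [mul_comm] using this

end Multiset

section NegSeq

variable {G : Type*} [AddCommGroup G] {U V : Multiset G}

/-- The sequence `-U` of the negatives of the terms of `U`. -/
def negSeq (U : Multiset G) : Multiset G := U.map Neg.neg

@[simp] lemma card_negSeq (U : Multiset G) : (negSeq U).card = U.card := by
  simp [negSeq]

@[simp] lemma sum_negSeq (U : Multiset G) : (negSeq U).sum = -U.sum :=
  Multiset.sum_map_neg' U

@[simp] lemma negSeq_add (U V : Multiset G) : negSeq (U + V) = negSeq U + negSeq V := by
  simp [negSeq]

@[simp] lemma negSeq_negSeq (U : Multiset G) : negSeq (negSeq U) = U := by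
  simp [negSeq]

@[simp] lemma negSeq_zero : negSeq (0 : Multiset G) = 0 := rfl

@[simp] lemma negSeq_cons (a : G) (U : Multiset G) : negSeq (a ::ₘ U) = -a ::ₘ negSeq U := by
  simp [negSeq]

lemma negSeq_le_negSeq (h : U ≤ V) : negSeq U ≤ negSeq V :=
  Multiset.map_le_map h

lemma negSeq_le_iff : negSeq U ≤ V ↔ U ≤ negSeq V :=
  ⟨fun h ↦ by simpa using negSeq_le_negSeq h, fun h ↦ by simpa using negSeq_le_negSeq h⟩

lemma exists_add_negSeq_eq_of_le {W A B : Multiset G} (h : W ≤ A + negSeq B) :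
    ∃ A' ≤ A, ∃ B' ≤ B, A' + negSeq B' = W := by
  obtain ⟨A', hA, B', hB, rfl⟩ := exists_add_eq_of_le_add h
  exact ⟨A', hA, negSeq B', negSeq_le_iff.mpr hB, by simp⟩

end NegSeq

section MinZeroSum

variable {G : Type*} [AddCommGroup G] {S T U V W : Multiset G} {z : Multiset (Multiset G)}

lemma IsMinZeroSum.neg (hU : IsMinZeroSum U) : IsMinZeroSum (negSeq U) :=
  hU.map (AddEquiv.neg G)

lemma IsFactorization.neg (hz : IsFactorization z S) :
    IsFactorization (z.map negSeq) (negSeq S) :=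
  hz.map (AddEquiv.neg G)

lemma IsMinZeroSum.eq_zero_of_card_lt (hU : IsMinZeroSum U) (hT : T ≤ U) (h0 : T.sum = 0)
    (hc : T.card < U.card) : T = 0 :=
  by_contra fun hne ↦ hc.ne (congrArg Multiset.card (hU.eq_of_le hT h0 hne))

lemma IsMinZeroSum.eq_singleton_zero (hU : IsMinZeroSum U) (h : 0 ∈ U) : U = {0} :=
  (hU.eq_of_le (Multiset.singleton_le.mpr h) (by simp) (by simp)).symm

lemma IsMinZeroSum.zero_notMem (hU : IsMinZeroSum U) (hc : 2 ≤ U.card) : 0 ∉ U := by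
  intro h0
  simp [hU.eq_singleton_zero h0] at hc

lemma IsMinZeroSum.two_le_card (hU : IsMinZeroSum U) (h : 0 ∉ U) : 2 ≤ U.card := by
  by_contra! hc
  interval_cases hn : U.card
  · exact hU.ne_zero (by simpa using hn)
  · obtain ⟨a, rfl⟩ := Multiset.card_eq_one.mp hn
    have ha : a = 0 := by simpa using hU.sum_eq_zero
    simp [ha] at h

lemma isMinZeroSum_pair {g : G} (hg : g ≠ 0) : IsMinZeroSum ({g, -g} : Multiset G) where
  ne_zero := by simp
  sum_eq_zero := by simp
  eq_of_le T hT h0 hne := by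
    refine Multiset.eq_of_le_of_card_le hT ?_
    by_contra! hc
    have hcard : T.card = 1 := by
      have := Multiset.card_pos.mpr hne
      rw [Multiset.card_pair] at hc
      omega
    obtain ⟨a, rfl⟩ := Multiset.card_eq_one.mp hcard
    have ha : a ∈ ({g, -g} : Multiset G) := Multiset.mem_of_le hT (by simp)
    obtain rfl : a = 0 := by simpa using h0
    simp [hg, eq_comm] at ha

lemma IsFactorization.le_of_mem (hz : IsFactorization z S) (hW : W ∈ z) : W ≤ S :=
  hz.sum_eq ▸ le_multiset_sum_of_mem hW

lemma isFactorization_zero : IsFactorization (0 : Multiset (Multiset G)) 0 where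
  isMinZeroSum := by simp
  sum_eq := by simp

lemma IsMinZeroSum.isFactorization (hU : IsMinZeroSum U) : IsFactorization {U} U where
  isMinZeroSum := by simpa
  sum_eq := by simp

lemma IsFactorization.add {y : Multiset (Multiset G)} (hz : IsFactorization z S)
    (hy : IsFactorization y T) : IsFactorization (z + y) (S + T) where
  isMinZeroSum W hW := (Multiset.mem_add.mp hW).elim (hz.isMinZeroSum W) (hy.isMinZeroSum W)
  sum_eq := by rw [Multiset.sum_add, hz.sum_eq, hy.sum_eq]

lemma IsFactorization.of_cons (hz : IsFactorization (W ::ₘ z) (W + S)) : IsFactorization z S where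
  isMinZeroSum V hV := hz.isMinZeroSum V (Multiset.mem_cons_of_mem hV)
  sum_eq := by simpa using hz.sum_eq

lemma IsFactorization.eq_zero (hz : IsFactorization z 0) : z = 0 := by
  by_contra hne
  obtain ⟨W, hW⟩ := Multiset.exists_mem_of_ne_zero hne
  exact (hz.isMinZeroSum W hW).ne_zero (Multiset.le_zero.mp (hz.le_of_mem hW))

lemma IsFactorization.eq_singleton (hz : IsFactorization z U) (hU : IsMinZeroSum U) : z = {U} := by
  have hne : z ≠ 0 := by
    rintro rfl
    exact hU.ne_zero (by simpa using hz.sum_eq.symm)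
  obtain ⟨W, hW⟩ := Multiset.exists_mem_of_ne_zero hne
  obtain rfl : W = U := hU.eq_of_le (hz.le_of_mem hW) (hz.isMinZeroSum W hW).sum_eq_zero
    (hz.isMinZeroSum W hW).ne_zero
  obtain ⟨t, rfl⟩ := Multiset.exists_cons_of_mem hW
  have ht : IsFactorization t 0 := .of_cons (W := W) (by simpa using hz)
  simp [ht.eq_zero]

lemma exists_isFactorization (hS : S.sum = 0) : ∃ z, IsFactorization z S := by
  induction hn : S.card using Nat.strong_induction_on generalizing S with
  | _ n ih =>
    by_cases h0 : S = 0
    · exact ⟨0, h0 ▸ isFactorization_zero⟩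
    by_cases hm : IsMinZeroSum S
    · exact ⟨{S}, hm.isFactorization⟩
    obtain ⟨T, hT, hT0, hne, hne'⟩ : ∃ T ≤ S, T.sum = 0 ∧ T ≠ 0 ∧ T ≠ S := by
      by_contra! hc
      exact hm ⟨h0, hS, hc⟩
    obtain ⟨R, rfl⟩ := Multiset.le_iff_exists_add.mp hT
    have hR0 : R.sum = 0 := by simpa [hT0] using hS
    have hTpos := Multiset.card_pos.mpr hne
    have hRpos : 0 < R.card := Multiset.card_pos.mpr fun h ↦ hne' (by simp [h])
    rw [Multiset.card_add] at hn
    obtain ⟨z, hz⟩ := ih T.card (by omega) hT0 rfl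
    obtain ⟨y, hy⟩ := ih R.card (by omega) hR0 rfl
    exact ⟨z + y, hz.add hy⟩

lemma IsFactorization.two_mul_card_le (hz : IsFactorization z S) (h0 : 0 ∉ S) :
    2 * z.card ≤ S.card := by
  rw [← hz.sum_eq]
  exact mul_card_le_card_sum fun W hW ↦ (hz.isMinZeroSum W hW).two_le_card
    fun h ↦ h0 (Multiset.mem_of_le (hz.le_of_mem hW) h)

lemma IsFactorization.card_eq_two_of_mem (hz : IsFactorization z (U + V)) (hV : IsMinZeroSum V)
    (hU : U ∈ z) : z.card = 2 := by
  obtain ⟨t, rfl⟩ := Multiset.exists_cons_of_mem hU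
  simp [hz.of_cons.eq_singleton hV]

lemma IsFactorization.card_eq_two_of_zero_mem (hz : IsFactorization z (U + V))
    (hU : IsMinZeroSum U) (hV : IsMinZeroSum V) (h0 : 0 ∈ U + V) : z.card = 2 := by
  wlog h : 0 ∈ U generalizing U V
  · exact this (add_comm U V ▸ hz) hV hU (add_comm U V ▸ h0)
      ((Multiset.mem_add.mp h0).resolve_left h)
  obtain ⟨W, hW, h0W⟩ : ∃ W ∈ z, (0 : G) ∈ W := by
    rwa [← hz.sum_eq, ← Multiset.join, Multiset.mem_join] at h0
  rw [(hz.isMinZeroSum W hW).eq_singleton_zero h0W, ← hU.eq_singleton_zero h] at hW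
  exact hz.card_eq_two_of_mem hV hW

end MinZeroSum

section LengthSet

variable {G : Type*} [AddCommGroup G] {S T U V : Multiset G} {k l : ℕ}

lemma add_mem_lengthSet (hk : k ∈ lengthSet S) (hl : l ∈ lengthSet T) :
    k + l ∈ lengthSet (S + T) := by
  obtain ⟨z, hz, rfl⟩ := hk
  obtain ⟨y, hy, rfl⟩ := hl
  exact ⟨z + y, hz.add hy, by simp⟩

lemma mem_lengthSet_negSeq (hk : k ∈ lengthSet S) : k ∈ lengthSet (negSeq S) := by
  obtain ⟨z, hz, rfl⟩ := hk
  exact ⟨_, hz.neg, by simp⟩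

lemma IsMinZeroSum.one_mem_lengthSet (hU : IsMinZeroSum U) : 1 ∈ lengthSet U :=
  ⟨{U}, hU.isFactorization, by simp⟩

lemma IsMinZeroSum.two_mem_lengthSet (hU : IsMinZeroSum U) (hV : IsMinZeroSum V) :
    2 ∈ lengthSet (U + V) :=
  add_mem_lengthSet hU.one_mem_lengthSet hV.one_mem_lengthSet

lemma card_mem_lengthSet (h0 : 0 ∉ S) : S.card ∈ lengthSet (S + negSeq S) := by
  induction S using Multiset.induction_on with
  | empty => exact ⟨0, isFactorization_zero, rfl⟩
  | cons a S ih =>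
    have ha : a ≠ 0 := fun h ↦ h0 (h ▸ Multiset.mem_cons_self _ _)
    have := add_mem_lengthSet (isMinZeroSum_pair ha).one_mem_lengthSet
      (ih fun h ↦ h0 (Multiset.mem_cons_of_mem h))
    rw [Multiset.card_cons, negSeq_cons, add_comm S.card, Multiset.cons_add, Multiset.add_cons]
    simpa using this

lemma exists_add_of_two_mem_lengthSet (h : 2 ∈ lengthSet S) :
    ∃ U V, IsMinZeroSum U ∧ IsMinZeroSum V ∧ S = U + V := by
  obtain ⟨z, hz, hc⟩ := h
  obtain ⟨U, V, rfl⟩ := Multiset.card_eq_two.mp hc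
  exact ⟨U, V, hz.isMinZeroSum U (by simp), hz.isMinZeroSum V (by simp), by simp [← hz.sum_eq]⟩

end LengthSet


section Davenport

variable {G : Type*} [AddCommGroup G] {S T U V W : Multiset G} {D k : ℕ}

/-- The sequence `S` has no non-empty zero-sum subsequence. -/
def IsZeroSumFree (S : Multiset G) : Prop :=
  ∀ T ≤ S, T.sum = 0 → T = 0

/-- The Davenport constant of `G`, the maximal length of a minimal zero-sum sequence, is at
most `D`. -/
def DavenportLE (G : Type*) [AddCommGroup G] (D : ℕ) : Prop :=
  ∀ U : Multiset G, IsMinZeroSum U → U.card ≤ D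

lemma IsZeroSumFree.isMinZeroSum_cons (hS : IsZeroSumFree S) : IsMinZeroSum (-S.sum ::ₘ S) where
  ne_zero := Multiset.cons_ne_zero
  sum_eq_zero := by simp
  eq_of_le T hT hT0 hne := by
    have hm : -S.sum ∈ T := by
      by_contra hm
      exact hne (hS T ((Multiset.le_cons_of_notMem hm).mp hT) hT0)
    obtain ⟨R, rfl⟩ := Multiset.exists_cons_of_mem hm
    obtain ⟨Q, rfl⟩ := Multiset.le_iff_exists_add.mp ((Multiset.cons_le_cons_iff _).mp hT)
    have hQ : Q.sum = 0 := by
      rw [Multiset.sum_cons, Multiset.sum_add] at hT0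
      simpa using hT0
    simp [hS Q (Multiset.le_add_left _ _) hQ]

lemma IsMinZeroSum.isZeroSumFree_of_cons {a : G} (hU : IsMinZeroSum (a ::ₘ S)) :
    IsZeroSumFree S := by
  intro T hT hT0
  refine hU.eq_zero_of_card_lt (hT.trans (Multiset.le_cons_self _ _)) hT0 ?_
  rw [Multiset.card_cons]
  exact Nat.lt_succ_of_le (Multiset.card_le_card hT)

lemma davenportLE_iff :
    DavenportLE G D ↔ ∀ S : Multiset G, D ≤ S.card → ¬ IsZeroSumFree S := by
  refine ⟨fun h S hS hfree ↦ ?_, fun h U hU ↦ ?_⟩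
  · have := h _ hfree.isMinZeroSum_cons
    rw [Multiset.card_cons] at this
    omega
  · by_contra! hlt
    obtain ⟨a, ha⟩ := Multiset.exists_mem_of_ne_zero hU.ne_zero
    obtain ⟨R, rfl⟩ := Multiset.exists_cons_of_mem ha
    rw [Multiset.card_cons] at hlt
    exact h R (by omega) hU.isZeroSumFree_of_cons

lemma DavenportLE.le_of_two_mem_lengthSet (hG : DavenportLE G D) (hD : 2 ≤ D)
    (h2 : 2 ∈ lengthSet S) (hk : k ∈ lengthSet S) : k ≤ D := by
  obtain ⟨U, V, hU, hV, rfl⟩ := exists_add_of_two_mem_lengthSet h2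
  obtain ⟨z, hz, rfl⟩ := hk
  by_cases h0 : (0 : G) ∈ U + V
  · rwa [hz.card_eq_two_of_zero_mem hU hV h0]
  · have hle := hz.two_mul_card_le h0
    have := hG U hU
    have := hG V hV
    rw [Multiset.card_add] at hle
    omega

lemma eq_pair_of_sum_eq_zero (h0 : W.sum = 0) (hc : W.card = 2) : ∃ x, W = {x, -x} := by
  obtain ⟨x, y, rfl⟩ := Multiset.card_eq_two.mp hc
  exact ⟨x, by rw [eq_neg_of_add_eq_zero_right (a := x) (b := y) (by simpa using h0)]⟩

lemma eq_negSeq_of_sum_eq_add {z : Multiset (Multiset G)}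
    (hz : ∀ W ∈ z, W.sum = 0 ∧ W.card = 2) (hs : z.sum = U + V)
    (hU : ∀ T ≤ U, T.sum = 0 → T.card ≠ 2) (hV : ∀ T ≤ V, T.sum = 0 → T.card ≠ 2) :
    V = negSeq U := by
  induction z using Multiset.induction_on generalizing U V with
  | empty =>
    obtain ⟨rfl, rfl⟩ := add_eq_zero.mp (hs.symm.trans Multiset.sum_zero)
    rfl
  | cons W z ih =>
    obtain ⟨hW0, hW2⟩ := hz W (Multiset.mem_cons_self _ _)
    obtain ⟨A, hA, B, hB, rfl⟩ :=
      exists_add_eq_of_le_add (hs ▸ le_multiset_sum_of_mem (Multiset.mem_cons_self W z))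
    rw [Multiset.card_add] at hW2
    rw [Multiset.sum_add] at hW0
    have hA2 : A.card ≠ 2 := fun h ↦ by
      have hB0 : B = 0 := Multiset.card_eq_zero.mp (by omega)
      exact hU A hA (by simpa [hB0] using hW0) h
    have hB2 : B.card ≠ 2 := fun h ↦ by
      have hA0 : A = 0 := Multiset.card_eq_zero.mp (by omega)
      exact hV B hB (by simpa [hA0] using hW0) h
    obtain ⟨a, rfl⟩ := Multiset.card_eq_one.mp (by omega : A.card = 1)
    obtain ⟨b, rfl⟩ := Multiset.card_eq_one.mp (by omega : B.card = 1)
    obtain rfl : b = -a := eq_neg_of_add_eq_zero_right (by simpa using hW0)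
    obtain ⟨U, rfl⟩ := Multiset.le_iff_exists_add.mp hA
    obtain ⟨V, rfl⟩ := Multiset.le_iff_exists_add.mp hB
    rw [Multiset.sum_cons, add_add_add_comm, add_right_inj] at hs
    rw [ih (fun W hW ↦ hz W (Multiset.mem_cons_of_mem hW)) hs
      (fun T hT ↦ hU T (hT.trans (Multiset.le_add_left _ _)))
      (fun T hT ↦ hV T (hT.trans (Multiset.le_add_left _ _))), negSeq_add]
    rfl

lemma IsFactorization.card_eq_two_of_mem_of_card_le {z : Multiset (Multiset G)}
    (hz : IsFactorization z S) (h0 : 0 ∉ S) (hc : S.card ≤ 2 * z.card) (hW : W ∈ z) :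
    W.card = 2 := by
  obtain ⟨t, rfl⟩ := Multiset.exists_cons_of_mem hW
  obtain rfl : W + t.sum = S := by simpa using hz.sum_eq
  have hWt := h0 ∘ Multiset.mem_add.mpr
  have h2W := (hz.isMinZeroSum W hW).two_le_card fun h ↦ hWt (.inl h)
  have h2t := hz.of_cons.two_mul_card_le fun h ↦ hWt (.inr h)
  rw [Multiset.card_add, Multiset.card_cons] at hc
  omega

/-- `U` is a minimal zero-sum sequence of maximal length, so that its length is the Davenport
constant of `G`. -/
structure IsLongestMinZeroSum (U : Multiset G) : Prop extends IsMinZeroSum U where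
  davenportLE : DavenportLE G U.card

lemma DavenportLE.exists_eq_add_negSeq (hG : DavenportLE G D) (hD : 3 ≤ D)
    (h2 : 2 ∈ lengthSet S) (hk : D ∈ lengthSet S) :
    ∃ U, IsLongestMinZeroSum U ∧ U.card = D ∧ S = U + negSeq U := by
  obtain ⟨U, V, hU, hV, rfl⟩ := exists_add_of_two_mem_lengthSet h2
  obtain ⟨z, hz, rfl⟩ := hk
  have h0 : (0 : G) ∉ U + V := fun h0 ↦ by
    have := hz.card_eq_two_of_zero_mem hU hV h0
    omega
  have hcU := hG U hU
  have hcV := hG V hV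
  have hle := hz.two_mul_card_le h0
  rw [Multiset.card_add] at hle
  have no_pair {X : Multiset G} (hX : IsMinZeroSum X) (hc : z.card = X.card) :
      ∀ T ≤ X, T.sum = 0 → T.card ≠ 2 := by
    intro T hT hT0 h
    have := hX.eq_zero_of_card_lt hT hT0 (by omega)
    simp [this] at h
  have hVU : V = negSeq U := eq_negSeq_of_sum_eq_add
    (fun W hW ↦ ⟨(hz.isMinZeroSum W hW).sum_eq_zero,
      hz.card_eq_two_of_mem_of_card_le h0 (by rw [Multiset.card_add]; omega) hW⟩)
    hz.sum_eq (no_pair hU (by omega)) (no_pair hV (by omega))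
  have hc : U.card = z.card := by omega
  exact ⟨U, ⟨hU, hc ▸ hG⟩, hc, by rw [hVU]⟩

lemma IsLongestMinZeroSum.exists_sum_eq {h : G} {R : Multiset G}
    (hU : IsLongestMinZeroSum (h ::ₘ R)) (x : G) : ∃ Y ≤ R, Y.sum = x := by
  obtain ⟨T, hT, hT0, hne⟩ : ∃ T ≤ -x ::ₘ R, T.sum = 0 ∧ T ≠ 0 := by
    simpa [IsZeroSumFree] using davenportLE_iff.mp hU.davenportLE (-x ::ₘ R) (by simp)
  have hm : -x ∈ T := by
    by_contra hm
    exact hne (hU.isZeroSumFree_of_cons T ((Multiset.le_cons_of_notMem hm).mp hT) hT0)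
  obtain ⟨Y, rfl⟩ := Multiset.exists_cons_of_mem hm
  exact ⟨Y, (Multiset.cons_le_cons_iff _).mp hT,
    (neg_add_eq_zero.mp (by simpa using hT0)).symm⟩

lemma IsLongestMinZeroSum.exists_sum_eq_of_mem (hU : IsLongestMinZeroSum U) {g h : G}
    (hh : h ∈ U) (hgh : g ≠ h) : ∃ Y ≤ U, h ∈ Y ∧ g ∉ Y ∧ Y.sum = g := by
  obtain ⟨R, rfl⟩ := Multiset.exists_cons_of_mem hh
  obtain ⟨Y, hY, hs⟩ := hU.exists_sum_eq (g - h)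
  have hs' : (h ::ₘ Y).sum = g := by simp [hs]
  refine ⟨h ::ₘ Y, (Multiset.cons_le_cons_iff h).mpr hY, by simp, fun hm ↦ ?_, hs'⟩
  -- If `g` occurred, then the other terms of `Y` and `h` would have sum zero.
  obtain ⟨Q, rfl⟩ := Multiset.exists_cons_of_mem ((Multiset.mem_cons.mp hm).resolve_left hgh)
  rw [Multiset.cons_swap, Multiset.sum_cons, add_eq_left] at hs'
  have hle : h ::ₘ Q ≤ h ::ₘ R :=
    (Multiset.cons_le_cons_iff h).mpr ((Multiset.le_cons_self _ _).trans hY)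
  refine Multiset.cons_ne_zero (hU.eq_zero_of_card_lt hle hs' ?_)
  have := Multiset.card_le_card hY
  simp only [Multiset.card_cons] at this ⊢
  omega

lemma IsLongestMinZeroSum.mem_of_forall_mem (hU : IsLongestMinZeroSum U) {K : AddSubgroup G}
    (hK : ∀ x ∈ U, x ∈ K) (x : G) : x ∈ K := by
  obtain ⟨a, ha⟩ := Multiset.exists_mem_of_ne_zero hU.ne_zero
  obtain ⟨R, rfl⟩ := Multiset.exists_cons_of_mem ha
  obtain ⟨Y, hY, rfl⟩ := hU.exists_sum_eq x
  exact K.multiset_sum_mem Y fun y hy ↦ hK y (Multiset.mem_cons_of_mem (Multiset.mem_of_le hY hy))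

lemma IsLongestMinZeroSum.finite (hU : IsLongestMinZeroSum U) : Finite G := by
  classical
  obtain ⟨a, ha⟩ := Multiset.exists_mem_of_ne_zero hU.ne_zero
  obtain ⟨R, rfl⟩ := Multiset.exists_cons_of_mem ha
  refine Set.finite_univ_iff.mp (((R.powerset.map Multiset.sum).toFinset.finite_toSet).subset
    fun x _ ↦ ?_)
  obtain ⟨Y, hY, rfl⟩ := hU.exists_sum_eq x
  simpa using ⟨Y, hY, rfl⟩

end Davenport

section SumRelation

variable {G : Type*} [AddCommGroup G] {U A B W : Multiset G} {k : ℕ}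

/-- A relation among the terms of `U`: distinct disjoint subsequences `A` and `B` of `U` with the
same sum. -/
structure IsSumRelation (U A B : Multiset G) : Prop where
  left_le : A ≤ U
  right_le : B ≤ U
  disjoint : Disjoint A B
  sum_eq : A.sum = B.sum
  ne : A ≠ B

lemma IsSumRelation.symm (h : IsSumRelation U A B) : IsSumRelation U B A :=
  ⟨h.right_le, h.left_le, h.disjoint.symm, h.sum_eq.symm, h.ne.symm⟩

lemma isSumRelation_sub [DecidableEq G] (hA : A ≤ U) (hB : B ≤ U) (hs : A.sum = B.sum)
    (hne : A ≠ B) : IsSumRelation U (A - B) (B - A) where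
  left_le := (Multiset.sub_le_self _ _).trans hA
  right_le := (Multiset.sub_le_self _ _).trans hB
  disjoint := by
    rw [Multiset.disjoint_left]
    intro x hx hx'
    rw [← Multiset.count_pos, Multiset.count_sub] at hx hx'
    omega
  sum_eq := by
    have h : A - B + B = B - A + A := by
      ext x
      simp only [Multiset.count_add, Multiset.count_sub]
      omega
    simpa [hs] using congrArg Multiset.sum h
  ne h := hne <| by
    ext x
    have := congrArg (Multiset.count x) h
    simp only [Multiset.count_sub] at this
    omega

lemma IsSumRelation.left_ne_zero (h : IsSumRelation U A B) (hU : IsMinZeroSum U) (hB : B ≠ U) :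
    A ≠ 0 := by
  rintro rfl
  exact hB (hU.eq_of_le h.right_le (by simpa using h.sum_eq.symm) h.ne.symm)

lemma IsSumRelation.three_le_card (h : IsSumRelation U A B) (hU : IsMinZeroSum U)
    (hc : 3 ≤ U.card) : 3 ≤ A.card + B.card := by
  by_contra! hlt
  have hA0 : A ≠ 0 := h.left_ne_zero hU fun h ↦ by rw [h] at hlt; omega
  have hB0 : B ≠ 0 := h.symm.left_ne_zero hU fun h ↦ by rw [h] at hlt; omega
  have := Multiset.card_pos.mpr hA0
  have := Multiset.card_pos.mpr hB0
  obtain ⟨a, rfl⟩ := Multiset.card_eq_one.mp (by omega : A.card = 1)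
  obtain ⟨b, rfl⟩ := Multiset.card_eq_one.mp (by omega : B.card = 1)
  exact h.ne (by simpa using h.sum_eq)

lemma IsMinZeroSum.isSumRelation (hW : IsMinZeroSum (A + negSeq B)) (hA : A ≤ U) (hB : B ≤ U)
    (hd : Disjoint A B) : IsSumRelation U A B where
  left_le := hA
  right_le := hB
  disjoint := hd
  sum_eq := by simpa [add_neg_eq_zero] using hW.sum_eq_zero
  ne := by
    rintro rfl
    exact hW.ne_zero (by simp [show A = 0 from disjoint_self.mp hd])

lemma IsMinZeroSum.card_eq_two_or_exists_isSumRelation (hW : IsMinZeroSum W)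
    (hle : W ≤ U + negSeq U) : W.card = 2 ∨ ∃ A B, IsSumRelation U A B ∧ W = A + negSeq B := by
  obtain ⟨A, hA, B, hB, rfl⟩ := exists_add_negSeq_eq_of_le hle
  by_cases hd : Disjoint A B
  · exact .inr ⟨A, B, hW.isSumRelation hA hB hd, rfl⟩
  · left
    simp only [Multiset.disjoint_left, not_forall, not_not] at hd
    obtain ⟨x, hxA, hxB⟩ := hd
    have hpair : ({x, -x} : Multiset G) ≤ A + negSeq B :=
      add_le_add (a := {x}) (c := {-x}) (by simpa using hxA)
        (by simpa [negSeq] using hxB)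
    rw [← hW.eq_of_le hpair (by simp) (by simp), Multiset.card_pair]

lemma exists_isSumRelation_of_mem_lengthSet (hU : IsMinZeroSum U)
    (hk : k ∈ lengthSet (U + negSeq U)) (hk2 : k ≠ 2) (hkU : k ≠ U.card) :
    ∃ A B, IsSumRelation U A B ∧ A ≠ 0 ∧ B ≠ 0 ∧ A + negSeq B ≠ U := by
  obtain ⟨z, hz, rfl⟩ := hk
  obtain ⟨W, hW, hW2⟩ : ∃ W ∈ z, W.card ≠ 2 := by
    by_contra! h
    apply hkU
    have hsum := Multiset.card_join z
    rw [Multiset.map_congr rfl h, Multiset.join, hz.sum_eq] at hsum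
    simp only [Multiset.card_add, card_negSeq, Multiset.map_const', Multiset.sum_replicate,
      smul_eq_mul] at hsum
    omega
  have hWU : W ≠ U := by
    rintro rfl
    exact hk2 (hz.card_eq_two_of_mem hU.neg hW)
  have hWU' : W ≠ negSeq U := by
    rintro rfl
    rw [add_comm] at hz
    exact hk2 (hz.card_eq_two_of_mem hU hW)
  obtain ⟨A, B, hAB, rfl⟩ :=
    ((hz.isMinZeroSum W hW).card_eq_two_or_exists_isSumRelation (hz.le_of_mem hW)).resolve_left hW2
  have hA0 : A ≠ 0 := by
    rintro rfl
    refine hAB.left_ne_zero hU (fun hB ↦ hWU' ?_) rfl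
    simp [hB]
  have hB0 : B ≠ 0 := by
    rintro rfl
    refine hAB.symm.left_ne_zero hU (fun hA ↦ hWU ?_) rfl
    simp [hA]
  exact ⟨A, B, hAB, hA0, hB0, hWU⟩

-- Factor `A + (-B)` and its negative, and pair the remaining terms of `U` with their negatives.
lemma IsSumRelation.exists_mem_lengthSet (h : IsSumRelation U A B) (hU : IsMinZeroSum U)
    (hc : 3 ≤ U.card) :
    ∃ p, 1 ≤ p ∧ 3 * p ≤ A.card + B.card ∧
      ∃ k ∈ lengthSet (U + negSeq U), k + (A.card + B.card) = U.card + 2 * p := by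
  obtain ⟨z, hz⟩ := exists_isFactorization (S := A + negSeq B) (by simp [h.sum_eq])
  have hz_pos : 1 ≤ z.card := by
    rw [Nat.one_le_iff_ne_zero, Ne, Multiset.card_eq_zero]
    rintro rfl
    obtain ⟨rfl, hB⟩ := add_eq_zero.mp (hz.sum_eq.symm.trans Multiset.sum_zero)
    exact h.ne (by simpa using congrArg negSeq hB.symm)
  have hz_card : 3 * z.card ≤ A.card + B.card := by
    rw [← card_negSeq B, ← Multiset.card_add, ← hz.sum_eq]
    refine mul_card_le_card_sum fun W hW ↦ ?_
    obtain ⟨A', hA', B', hB', rfl⟩ := exists_add_negSeq_eq_of_le (hz.le_of_mem hW)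
    have hAB' : IsSumRelation U A' B' := (hz.isMinZeroSum _ hW).isSumRelation
      (hA'.trans h.left_le) (hB'.trans h.right_le) (h.disjoint.mono hA' hB')
    simpa using hAB'.three_le_card hU hc
  obtain ⟨R, rfl⟩ :=
    Multiset.le_iff_exists_add.mp (add_le_of_disjoint h.left_le h.right_le h.disjoint)
  have hR0 : (0 : G) ∉ R := fun h0 ↦
    hU.zero_notMem (by omega) (Multiset.mem_add.mpr (.inr h0))
  have hAB : z.card ∈ lengthSet (A + negSeq B) := ⟨z, hz, rfl⟩
  have key := add_mem_lengthSet (add_mem_lengthSet hAB (mem_lengthSet_negSeq hAB))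
    (card_mem_lengthSet hR0)
  refine ⟨z.card, hz_pos, hz_card, z.card + z.card + R.card, ?_, ?_⟩
  · convert key using 1
    simp only [negSeq_add, negSeq_negSeq]
    ac_rfl
  · simp only [Multiset.card_add]
    ring

end SumRelation


section DirectProduct

variable {G : Type*} [AddCommGroup G]

lemma nonempty_addEquiv_prod_zmod {K : AddSubgroup G} {m : ℕ} {g : G} (hm : 0 < m)
    (hg : m • g = 0) (hord : ∀ i, 0 < i → i < m → i • g ∉ K)
    (hgen : ∀ x, x ∈ K ⊔ AddSubgroup.zmultiples g) : Nonempty (G ≃+ K × ZMod m) := by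
  have : NeZero m := ⟨hm.ne'⟩
  let multiples : ZMod m →+ G := ZMod.lift m ⟨zmultiplesHom G g, by simp [hg]⟩
  have multiples_intCast (i : ℤ) : multiples i = i • g := by simp [multiples]
  let f : K × ZMod m →+ G := K.subtype.coprod multiples
  refine ⟨(AddEquiv.ofBijective f ⟨?_, fun x ↦ ?_⟩).symm⟩
  · rw [injective_iff_map_eq_zero]
    rintro ⟨a, b⟩ hab
    have hb : multiples b = b.val • g := by
      rw [← natCast_zsmul, ← multiples_intCast, Int.cast_natCast, ZMod.natCast_zmod_val]
    have hab' : (a : G) + b.val • g = 0 := hb ▸ hab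
    have hmem : b.val • g ∈ K := by
      rw [eq_neg_of_add_eq_zero_right hab']
      exact K.neg_mem a.2
    have hb0 : b.val = 0 := by
      by_contra hpos
      exact hord _ (Nat.pos_of_ne_zero hpos) (ZMod.val_lt b) hmem
    rw [hb0, zero_nsmul, add_zero] at hab'
    simp only [Prod.mk_eq_zero]
    exact ⟨Subtype.ext hab', (ZMod.val_eq_zero b).mp hb0⟩
  · obtain ⟨a, ha, y, hy, rfl⟩ := AddSubgroup.mem_sup.mp (hgen x)
    obtain ⟨i, rfl⟩ := AddSubgroup.mem_zmultiples_iff.mp hy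
    exact ⟨(⟨a, ha⟩, i), congrArg (a + ·) (multiples_intCast i)⟩

lemma nonempty_zmultiples_addEquiv_zmod (e : G) :
    Nonempty (AddSubgroup.zmultiples e ≃+ ZMod (addOrderOf e)) := by
  rw [← Nat.card_zmultiples]
  exact ⟨(zmodAddCyclicAddEquiv inferInstance).symm⟩

end DirectProduct

section Terms

variable {G : Type*} [AddCommGroup G] {U : Multiset G} {k : ℕ}

lemma IsMinZeroSum.add_ne_zero {x y : G} (hU : IsMinZeroSum U) (hc : 3 ≤ U.card)
    (h : {x, y} ≤ U) : x + y ≠ 0 := by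
  intro h0
  have := hU.eq_zero_of_card_lt h (by simpa using h0) (by rw [Multiset.card_pair]; omega)
  simp at this

lemma IsMinZeroSum.count_le_one [DecidableEq G] {x : G} (hU : IsMinZeroSum U)
    (hc : 3 ≤ U.card) (h : x + x = 0) : U.count x ≤ 1 := by
  by_contra! hlt
  exact hU.add_ne_zero hc (x := x) (y := x) (Multiset.le_count_iff_replicate_le.mp hlt) h

lemma exists_add_self_ne_zero (hU : IsMinZeroSum U) (hk : k ∈ lengthSet (U + negSeq U))
    (hk2 : k ≠ 2) (hkU : k ≠ U.card) : ∃ g ∈ U, g + g ≠ 0 := by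
  obtain ⟨A, B, h, hA0, -, hABU⟩ := exists_isSumRelation_of_mem_lengthSet hU hk hk2 hkU
  by_contra! hall
  have hneg : negSeq B = B := by
    have : B.map Neg.neg = B.map id := Multiset.map_congr rfl fun x hx ↦
      neg_eq_iff_add_eq_zero.mpr (hall x (Multiset.mem_of_le h.right_le hx))
    simpa [negSeq] using this
  have hsum : (A + B).sum = 0 := by
    rw [Multiset.sum_add, h.sum_eq]
    nth_rw 2 [← hneg]
    simp
  exact hABU (hneg.symm ▸ hU.eq_of_le (add_le_of_disjoint h.left_le h.right_le h.disjoint) hsum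
    fun h ↦ hA0 (add_eq_zero.mp h).1)

lemma exists_mem_ne (hU : IsMinZeroSum U) (hk : k ∈ lengthSet (U + negSeq U))
    (hk2 : k ≠ 2) (hkU : k ≠ U.card) (g : G) : ∃ h ∈ U, h ≠ g := by
  obtain ⟨A, B, h, hA0, hB0, -⟩ := exists_isSumRelation_of_mem_lengthSet hU hk hk2 hkU
  by_contra! hall
  obtain ⟨a, ha⟩ := Multiset.exists_mem_of_ne_zero hA0
  obtain ⟨b, hb⟩ := Multiset.exists_mem_of_ne_zero hB0
  obtain rfl := hall a (Multiset.mem_of_le h.left_le ha)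
  obtain rfl := hall b (Multiset.mem_of_le h.right_le hb)
  exact Multiset.disjoint_left.mp h.disjoint ha hb

end Terms

section RankTwo

variable {G : Type*} [AddCommGroup G] {U A B : Multiset G} {g e : G}

lemma IsSumRelation.card_eq_three_or_eq_card (h : IsSumRelation U A B) (hU : IsMinZeroSum U)
    (hc : 5 ≤ U.card) (hL : lengthSet (U + negSeq U) ⊆ {2, U.card - 1, U.card}) :
    A.card + B.card = 3 ∨ A.card + B.card = U.card := by
  obtain ⟨p, hp, h3p, k, hkL, hk⟩ := h.exists_mem_lengthSet hU (by omega)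
  have hle := Multiset.card_le_card (add_le_of_disjoint h.left_le h.right_le h.disjoint)
  rw [Multiset.card_add] at hle
  rcases hL hkL with rfl | rfl | rfl <;> omega

lemma exists_eq_add_of_add_self_ne_zero (hU : IsLongestMinZeroSum U) (hc : 5 ≤ U.card)
    (hL : lengthSet (U + negSeq U) ⊆ {2, U.card - 1, U.card}) {h : G} (hg : g ∈ U) (hh : h ∈ U)
    (hgh : g ≠ h) (hgg : g + g ≠ 0) : ∃ k ∈ U, g = h + k := by
  obtain ⟨Y, hY, hhY, hgY, hYs⟩ := hU.exists_sum_eq_of_mem hh hgh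
  have hrel : IsSumRelation U {g} Y :=
    ⟨Multiset.singleton_le.mpr hg, hY, by simpa using hgY, by simp [hYs],
      fun h ↦ hgY (h ▸ Multiset.mem_singleton_self g)⟩
  have hcard : Y.card = 2 := by
    have hor := hrel.card_eq_three_or_eq_card hU.toIsMinZeroSum hc hL
    rw [Multiset.card_singleton] at hor
    suffices 1 + Y.card = 3 by omega
    refine hor.resolve_right fun hYU ↦ hgg ?_
    have hU_eq : {g} + Y = U := Multiset.eq_of_le_of_card_le
      (add_le_of_disjoint hrel.left_le hY hrel.disjoint) (by simp [← hYU, add_comm])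
    simpa [← hU_eq, hYs] using hU.sum_eq_zero
  obtain ⟨Z, rfl⟩ := Multiset.exists_cons_of_mem hhY
  obtain ⟨k, rfl⟩ := Multiset.card_eq_one.mp (by simpa using hcard : Z.card = 1)
  exact ⟨k, Multiset.mem_of_le hY (by simp), by simpa using hYs.symm⟩

lemma exists_eq_add_of_add_self_eq_zero (hU : IsLongestMinZeroSum U) (hc : 5 ≤ U.card)
    (hL : lengthSet (U + negSeq U) ⊆ {2, U.card - 1, U.card}) {h : G} (hg : g ∈ U) (hh : h ∈ U)
    (hgh : g ≠ h) (hgg : g + g ≠ 0) (hhh : h + h ≠ 0) : ∃ e ∈ U, e + e = 0 ∧ g = h + e := by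
  obtain ⟨k, hk, hgk⟩ := exists_eq_add_of_add_self_ne_zero hU hc hL hg hh hgh hgg
  obtain ⟨l, hl, hhl⟩ := exists_eq_add_of_add_self_ne_zero hU hc hL hh hg hgh.symm hhh
  have hkl : k + l = 0 := by
    rw [hgk, add_assoc, left_eq_add] at hhl
    exact hhl
  by_cases h : k = l
  · subst h
    exact ⟨k, hk, hkl, hgk⟩
  · exact absurd hkl (hU.add_ne_zero (by omega) (pair_le_of_ne h hk hl))

lemma exists_mem_mem_add_mem (hU : IsLongestMinZeroSum U) (hc : 5 ≤ U.card)
    (hL : lengthSet (U + negSeq U) = {2, U.card - 1, U.card}) :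
    ∃ g ∈ U, ∃ e ∈ U, g + e ∈ U ∧ g + g ≠ 0 ∧ e + e = 0 := by
  have hmem : U.card - 1 ∈ lengthSet (U + negSeq U) := by simp [hL]
  obtain ⟨g, hg, hgg⟩ :=
    exists_add_self_ne_zero hU.toIsMinZeroSum hmem (by omega) (by omega)
  obtain ⟨h, hh, hhg⟩ :=
    exists_mem_ne hU.toIsMinZeroSum hmem (by omega) (by omega) g
  by_cases hhh : h + h = 0
  · obtain ⟨k, hk, rfl⟩ :=
      exists_eq_add_of_add_self_ne_zero hU hc hL.subset hg hh hhg.symm hgg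
    refine ⟨k, hk, h, hh, add_comm h k ▸ hg, fun hkk ↦ hgg ?_, hhh⟩
    rw [add_add_add_comm, hhh, hkk, add_zero]
  · obtain ⟨e, he, hee, rfl⟩ :=
      exists_eq_add_of_add_self_eq_zero hU hc hL.subset hh hg hhg hhh hgg
    exact ⟨g, hg, e, he, hh, hgg, hee⟩

lemma add_add_self_of_add_self_eq_zero (hee : e + e = 0) (x : G) : x + e + (x + e) = x + x := by
  rw [add_add_add_comm, hee, add_zero]

lemma eq_or_eq_add_of_add_self_ne_zero (hU : IsLongestMinZeroSum U) (hc : 5 ≤ U.card)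
    (hL : lengthSet (U + negSeq U) ⊆ {2, U.card - 1, U.card}) (hg : g ∈ U) (he : e ∈ U)
    (hge : g + e ∈ U) (hgg : g + g ≠ 0) (hee : e + e = 0) {x : G} (hx : x ∈ U) (hxx : x + x ≠ 0) :
    x = g ∨ x = g + e := by
  by_contra! hne
  obtain ⟨e₁, he₁, hee₁, hx₁⟩ :=
    exists_eq_add_of_add_self_eq_zero hU hc hL hx hg hne.1 hxx hgg
  obtain ⟨e₂, he₂, hee₂, hx₂⟩ := exists_eq_add_of_add_self_eq_zero hU hc hL hx hge hne.2 hxx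
    (by rwa [add_add_self_of_add_self_eq_zero hee])
  have hsum : e₁ = e + e₂ := add_left_cancel (a := g) (by rw [← hx₁, hx₂, add_assoc])
  have h₁ : e ≠ e₁ := by
    rintro rfl
    exact hne.2 hx₁
  have h₂ : e ≠ e₂ := by
    rintro rfl
    exact hne.1 (by rw [hx₂, add_assoc, hee, add_zero])
  have h₁₂ : e₁ ≠ e₂ := by
    rintro rfl
    rw [right_eq_add] at hsum
    exact hU.zero_notMem (by omega) (hsum ▸ he)
  have htriple : ({e, e₁, e₂} : Multiset G) ≤ U :=
    (Multiset.cons_le_of_notMem (by simp [h₁, h₂])).mpr ⟨he, pair_le_of_ne h₁₂ he₁ he₂⟩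
  have hsum0 : ({e, e₁, e₂} : Multiset G).sum = 0 := by
    simp only [Multiset.insert_eq_cons, Multiset.sum_cons, Multiset.sum_singleton]
    rw [hsum, add_assoc, hee₂, add_zero, hee]
  have := hU.eq_zero_of_card_lt htriple hsum0 (by simp; omega)
  simp at this

lemma eq_or_eq_add_or_eq (hU : IsLongestMinZeroSum U) (hc : 5 ≤ U.card)
    (hL : lengthSet (U + negSeq U) ⊆ {2, U.card - 1, U.card}) (hg : g ∈ U) (he : e ∈ U)
    (hge : g + e ∈ U) (hgg : g + g ≠ 0) (hee : e + e = 0) {x : G} (hx : x ∈ U) :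
    x = g ∨ x = g + e ∨ x = e := by
  by_cases hxx : x + x = 0
  · obtain ⟨k, hk, hgk⟩ := exists_eq_add_of_add_self_ne_zero hU hc hL hg hx
      (fun h ↦ hgg (h ▸ hxx)) hgg
    have hkk : k + k ≠ 0 := by
      rwa [hgk, add_comm x, add_add_self_of_add_self_eq_zero hxx] at hgg
    rcases eq_or_eq_add_of_add_self_ne_zero hU hc hL hg he hge hgg hee hk hkk with rfl | rfl
    · rw [right_eq_add] at hgk
      exact absurd (hgk ▸ hx) (hU.zero_notMem (by omega))
    · rw [add_left_comm, left_eq_add] at hgk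
      exact .inr (.inr (add_right_cancel (hgk.trans hee.symm)))
  · exact (eq_or_eq_add_of_add_self_ne_zero hU hc hL hg he hge hgg hee hx hxx).imp_right .inl

lemma count_eq_one_or_count_add_eq_one [DecidableEq G] (hU : IsMinZeroSum U) (hc : 5 ≤ U.card)
    (hL : lengthSet (U + negSeq U) ⊆ {2, U.card - 1, U.card}) (hg : g ∈ U) (he : e ∈ U)
    (hge : g + e ∈ U) (hee : e + e = 0) : U.count g = 1 ∨ U.count (g + e) = 1 := by
  by_contra! hne
  have hne_add : g ≠ g + e := by
    rw [Ne, left_eq_add]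
    rintro rfl
    exact hU.zero_notMem (by omega) he
  have hg2 := Multiset.one_le_count_iff_mem.mpr hg
  have hge2 := Multiset.one_le_count_iff_mem.mpr hge
  have hrel : IsSumRelation U (Multiset.replicate 2 g) (Multiset.replicate 2 (g + e)) := by
    refine ⟨Multiset.le_count_iff_replicate_le.mp (by omega),
      Multiset.le_count_iff_replicate_le.mp (by omega), ?_, ?_, ?_⟩
    · rw [Multiset.disjoint_left]
      intro x hx hx'
      rw [Multiset.mem_replicate] at hx hx'
      exact hne_add (hx.2.symm.trans hx'.2)
    · simp only [Multiset.sum_replicate, two_nsmul, add_add_self_of_add_self_eq_zero hee]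
    · intro h
      exact hne_add (Multiset.replicate_right_inj two_ne_zero |>.mp h)
  have := hrel.card_eq_three_or_eq_card hU hc hL
  simp only [Multiset.card_replicate] at this
  omega

lemma eq_replicate_add_pair [DecidableEq G] (hU : IsMinZeroSum U) (hc : 3 ≤ U.card)
    (he : e ∈ U) (hgg : g + g ≠ 0) (hee : e + e = 0) (hcount : U.count (g + e) = 1)
    (hsupp : ∀ x ∈ U, x = g ∨ x = g + e ∨ x = e) :
    U = Multiset.replicate (U.card - 2) g + {g + e, e} := by
  have he0 : e ≠ 0 := fun h ↦ hU.zero_notMem (by omega) (h ▸ he)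
  have hg0 : g ≠ 0 := fun h ↦ hgg (by rw [h, add_zero])
  have hg_ne : g ≠ e := fun h ↦ hgg (h ▸ hee)
  have hcount_e : U.count e = 1 := le_antisymm (hU.count_le_one (by omega) hee)
    (Multiset.one_le_count_iff_mem.mpr he)
  have hU_eq : U = Multiset.replicate (U.count g) g + {g + e, e} := by
    ext x
    rw [Multiset.count_add, Multiset.count_replicate, Multiset.insert_eq_cons,
      Multiset.count_cons, Multiset.count_singleton]
    by_cases hx : x = g ∨ x = g + e ∨ x = e
    · rcases hx with rfl | rfl | rfl
      · simp [he0, hg_ne]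
      · simp [he0, hg0, hcount]
      · simp [hg_ne, hg0, hcount_e]
    · rw [Multiset.count_eq_zero.mpr (mt (hsupp x) hx)]
      push Not at hx
      simp [hx.1.symm, hx.2.1, hx.2.2]
  have hcard := congrArg Multiset.card hU_eq
  rw [Multiset.card_add, Multiset.card_replicate, Multiset.card_pair] at hcard
  rwa [show U.card - 2 = U.count g by omega]

lemma eq_zero_or_eq_of_mem_zmultiples (hee : e + e = 0) (hg : g ∈ AddSubgroup.zmultiples e) :
    g = 0 ∨ g = e := by
  obtain ⟨j, rfl⟩ := hg
  dsimp only
  rcases Int.even_or_odd' j with ⟨l, rfl | rfl⟩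
  · exact .inl (by rw [mul_comm, mul_zsmul, two_zsmul, hee, zsmul_zero])
  · exact .inr (by rw [add_zsmul, mul_comm, mul_zsmul, two_zsmul, hee, zsmul_zero, one_zsmul,
      zero_add])

lemma IsMinZeroSum.nsmul_ne_zero {i : ℕ} (hU : IsMinZeroSum U)
    (hle : Multiset.replicate i g ≤ U) (hi0 : 0 < i) (hi : i < U.card) : i • g ≠ 0 := by
  intro h0
  have := hU.eq_zero_of_card_lt hle (by simpa using h0) (by simpa using hi)
  simpa [hi0.ne'] using congrArg Multiset.card this

lemma nsmul_notMem_zmultiples (hU : IsMinZeroSum U) (hc : 5 ≤ U.card)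
    (hL : lengthSet (U + negSeq U) ⊆ {2, U.card - 1, U.card}) (hee : e + e = 0)
    (hge : g ≠ e) (hU_eq : U = Multiset.replicate (U.card - 2) g + {g + e, e}) {i : ℕ}
    (hi0 : 0 < i) (hi : i < U.card - 1) : i • g ∉ AddSubgroup.zmultiples e := by
  have hrep {j : ℕ} (hj : j ≤ U.card - 2) : Multiset.replicate j g ≤ U := by
    rw [hU_eq]
    exact ((Multiset.replicate_le_replicate g).mpr hj).trans (Multiset.le_add_right _ _)
  have hord {j : ℕ} (hj0 : 0 < j) (hj : j < U.card - 1) : j • g ≠ 0 :=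
    hU.nsmul_ne_zero (hrep (by omega)) hj0 (by omega)
  have he : e ∈ U := by
    rw [hU_eq]
    simp
  intro hmem
  rcases eq_zero_or_eq_of_mem_zmultiples hee hmem with h0 | hie
  · exact hord hi0 hi h0
  · have hdisj : Disjoint (Multiset.replicate i g) {e} := by
      simp [Multiset.mem_replicate, hge.symm]
    have hrel : IsSumRelation U (Multiset.replicate i g) {e} :=
      ⟨hrep (by omega), Multiset.singleton_le.mpr he, hdisj, by simpa using hie, by
        rintro h
        simp [h] at hdisj⟩
    have hcard := hrel.card_eq_three_or_eq_card hU hc hL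
    rw [Multiset.card_replicate, Multiset.card_singleton] at hcard
    -- The relation has length three, so `e = 2g` and hence `4g = 0`.
    obtain rfl : i = 2 := by omega
    have h4 : 4 • g = 0 := by
      rw [← hie, ← add_nsmul] at hee
      exact hee
    by_cases hc5 : U.card = 5
    · have hg : g ∈ U := Multiset.singleton_le.mp (hrep (j := 1) (by omega))
      have hge_mem : g + e ∈ U := by
        rw [hU_eq]
        simp
      have he0 : e ≠ 0 := fun h ↦ hU.zero_notMem (by omega) (h ▸ he)
      refine hU.add_ne_zero (by omega) (pair_le_of_ne (by simpa using he0) hg hge_mem) ?_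
      rw [← hie, ← add_assoc, ← two_nsmul, ← add_nsmul]
      exact h4
    · exact hord (j := 4) (by omega) (by omega) h4

theorem IsLongestMinZeroSum.nonempty_addEquiv_zmod_two_prod (hU : IsLongestMinZeroSum U)
    (hc : 5 ≤ U.card) (hL : lengthSet (U + negSeq U) = {2, U.card - 1, U.card}) :
    Nonempty (G ≃+ ZMod 2 × ZMod (U.card - 1)) := by
  classical
  have hU' := hU.toIsMinZeroSum
  obtain ⟨g, hg, e, he, hge, hgg, hee⟩ := exists_mem_mem_add_mem hU hc hL
  wlog hcount : U.count (g + e) = 1 generalizing g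
  · have hg_eq : g = g + e + e := by rw [add_assoc, hee, add_zero]
    exact this (g + e) hge (hg_eq ▸ hg) (by rwa [add_add_self_of_add_self_eq_zero hee])
      (hg_eq ▸ (count_eq_one_or_count_add_eq_one hU' hc hL.subset hg he hge hee).resolve_right
        hcount)
  have hsupp := fun x (hx : x ∈ U) ↦ eq_or_eq_add_or_eq hU hc hL.subset hg he hge hgg hee hx
  have hU_eq := eq_replicate_add_pair hU' (by omega) he hgg hee hcount hsupp
  have hsum : (U.card - 1) • g = 0 := by
    rw [show U.card - 1 = U.card - 2 + 1 by omega, succ_nsmul]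
    have h0 := hU.sum_eq_zero
    rw [hU_eq, Multiset.sum_add, Multiset.sum_replicate, Multiset.insert_eq_cons,
      Multiset.sum_cons, Multiset.sum_singleton, add_assoc g, hee, add_zero] at h0
    exact h0
  obtain ⟨f⟩ := nonempty_addEquiv_prod_zmod (K := AddSubgroup.zmultiples e) (g := g)
    (by omega) hsum (fun i hi0 hi ↦ nsmul_notMem_zmultiples hU' hc hL.subset hee
      (by rintro rfl; exact hgg hee) hU_eq hi0 hi) <| hU.mem_of_forall_mem fun x hx ↦ by
    have hgK := AddSubgroup.mem_sup_right (S := AddSubgroup.zmultiples e)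
      (AddSubgroup.mem_zmultiples g)
    have heK := AddSubgroup.mem_sup_left (T := AddSubgroup.zmultiples g)
      (AddSubgroup.mem_zmultiples e)
    rcases hsupp x hx with rfl | rfl | rfl
    exacts [hgK, add_mem hgK heK, heK]
  have he2 : addOrderOf e = 2 := addOrderOf_eq_prime (by rwa [two_nsmul])
    fun h ↦ hU.zero_notMem (by omega) (h ▸ he)
  obtain ⟨f₂⟩ := nonempty_zmultiples_addEquiv_zmod e
  rw [he2] at f₂
  exact ⟨f.trans (f₂.prodCongr (.refl _))⟩

end RankTwo


section Multiset

variable {α : Type*} {U S : Multiset α} {a : α}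

lemma notMem_of_count_cons_eq_one [DecidableEq α] (h : (a ::ₘ S).count a = 1) : a ∉ S := by
  rwa [Multiset.count_cons_self, Nat.add_eq_right, Multiset.count_eq_zero] at h

lemma exists_eq_add_singleton (hS : S ≤ U) (hc : U.card = S.card + 1) : ∃ a, U = S + {a} := by
  obtain ⟨R, rfl⟩ := Multiset.le_iff_exists_add.mp hS
  obtain ⟨a, rfl⟩ := Multiset.card_eq_one.mp (by simpa using hc)
  exact ⟨a, rfl⟩

lemma card_lt_natCard [Finite α] (hU : U.Nodup) (ha : a ∉ U) : U.card < Nat.card α := by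
  have := Fintype.ofFinite α
  rw [Nat.card_eq_fintype_card]
  exact (Finset.mk (a ::ₘ U) (Multiset.nodup_cons.mpr ⟨ha, hU⟩)).card_le_univ.trans_lt' (by simp)

end Multiset

section LargeRank

variable {G : Type*} [AddCommGroup G] {U A B : Multiset G} {g h k : G} {D : ℕ}

lemma DavenportLE.exists_nsmul_add_sum_eq_zero (hG : DavenportLE G D) (g : G) {m : ℕ}
    {R : Multiset G} (hm : D ≤ m + R.card) :
    ∃ i ≤ m, ∃ Q ≤ R, i • g + Q.sum = 0 ∧ (i ≠ 0 ∨ Q ≠ 0) := by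
  obtain ⟨T, hT, hT0, hne⟩ : ∃ T ≤ Multiset.replicate m g + R, T.sum = 0 ∧ T ≠ 0 := by
    simpa [IsZeroSumFree] using davenportLE_iff.mp hG (Multiset.replicate m g + R) (by simpa)
  obtain ⟨A, hA, Q, hQ, rfl⟩ := exists_add_eq_of_le_add hT
  obtain ⟨i, hi, rfl⟩ := Multiset.le_replicate_iff.mp hA
  refine ⟨i, hi, Q, hQ, by simpa using hT0, ?_⟩
  by_contra! h
  exact hne (by simp [h])

lemma DavenportLE.addOrderOf_le (hG : DavenportLE G D) (g : G) : addOrderOf g ≤ D := by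
  obtain ⟨i, hi, Q, hQ, h0, hne⟩ := hG.exists_nsmul_add_sum_eq_zero g (m := D) (R := 0) (by simp)
  obtain rfl := Multiset.le_zero.mp hQ
  have hi0 : i ≠ 0 := by simpa using hne
  exact (addOrderOf_le_of_nsmul_eq_zero (Nat.pos_of_ne_zero hi0) (by simpa using h0)).trans hi

lemma DavenportLE.mem_zmultiples (hG : DavenportLE G (addOrderOf g)) (x : G) :
    x ∈ AddSubgroup.zmultiples g := by
  obtain ⟨i, hi, Q, hQ, h0, hne⟩ :=
    hG.exists_nsmul_add_sum_eq_zero g (m := addOrderOf g - 1) (R := {x}) (by simp; omega)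
  rcases Multiset.le_singleton.mp hQ with rfl | rfl
  · have hi0 : i ≠ 0 := by simpa using hne
    have := addOrderOf_le_of_nsmul_eq_zero (x := g) (Nat.pos_of_ne_zero hi0) (by simpa using h0)
    omega
  · rw [Multiset.sum_singleton] at h0
    rw [eq_neg_of_add_eq_zero_right h0]
    exact neg_mem (AddSubgroup.nsmul_mem_zmultiples g i)

lemma IsSumRelation.sub_two_le_card (h : IsSumRelation U A B) (hU : IsMinZeroSum U)
    (hc : 6 ≤ U.card) (hL : lengthSet (U + negSeq U) ⊆ {2, 4, U.card}) :
    A.card + B.card = U.card - 2 ∨ A.card + B.card = U.card := by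
  obtain ⟨p, hp, h3p, k, hkL, hk⟩ := h.exists_mem_lengthSet hU (by omega)
  have hle := Multiset.card_le_card (add_le_of_disjoint h.left_le h.right_le h.disjoint)
  rw [Multiset.card_add] at hle
  rcases hL hkL with rfl | rfl | rfl <;> omega

lemma eq_of_sum_eq_of_card_lt (hU : IsMinZeroSum U) (hc : 6 ≤ U.card)
    (hL : lengthSet (U + negSeq U) ⊆ {2, 4, U.card}) (hA : A ≤ U) (hB : B ≤ U)
    (hs : A.sum = B.sum) (hlt : A.card + B.card < U.card - 2) : A = B := by
  classical
  by_contra hne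
  have := (isSumRelation_sub hA hB hs hne).sub_two_le_card hU hc hL
  have := Multiset.card_le_card (Multiset.sub_le_self A B)
  have := Multiset.card_le_card (Multiset.sub_le_self B A)
  omega

lemma exists_eq_cons_cons_cons (hU : IsLongestMinZeroSum U) (hc : 6 ≤ U.card)
    (hL : lengthSet (U + negSeq U) ⊆ {2, 4, U.card}) (hg : g ∈ U) (hh : h ∈ U) (hgh : g ≠ h)
    (hgg : g + g ≠ 0) :
    ∃ l l' Y, U = g ::ₘ l ::ₘ l' ::ₘ Y ∧ g ∉ Y ∧ h ∈ Y ∧ g + g + (l + l') = 0 := by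
  obtain ⟨Y, hY, hhY, hgY, hYs⟩ := hU.exists_sum_eq_of_mem hh hgh
  have hrel : IsSumRelation U {g} Y :=
    ⟨Multiset.singleton_le.mpr hg, hY, by simpa using hgY, by simp [hYs],
      fun h ↦ hgY (h ▸ Multiset.mem_singleton_self g)⟩
  have hcard := hrel.sub_two_le_card hU.toIsMinZeroSum hc hL
  obtain ⟨R, hR⟩ := Multiset.le_iff_exists_add.mp
    (add_le_of_disjoint hrel.left_le hY hrel.disjoint)
  have hRc := congrArg Multiset.card hR
  simp only [Multiset.card_add, Multiset.card_singleton] at hcard hRc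
  have hsum : g + g + R.sum = 0 := by
    simpa [hR, hYs, add_assoc] using hU.sum_eq_zero
  have hR2 : R.card = 2 := by
    by_contra hne
    obtain rfl : R = 0 := Multiset.card_eq_zero.mp (by omega)
    exact hgg (by simpa using hsum)
  obtain ⟨l, l', rfl⟩ := Multiset.card_eq_two.mp hR2
  refine ⟨l, l', Y, ?_, hgY, hhY, by simpa using hsum⟩
  rw [hR]
  simp only [Multiset.insert_eq_cons, ← Multiset.singleton_add]
  abel

lemma IsMinZeroSum.lt_of_nsmul_add_sum_eq_zero {i n : ℕ} {Q : Multiset G} (hU : IsMinZeroSum U)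
    (hle : Multiset.replicate n g + Q ≤ U) (hc : n + Q.card < U.card)
    (h0 : i • g + Q.sum = 0) (hiQ : i ≠ 0 ∨ Q ≠ 0) : n < i := by
  by_contra! hin
  have hle' : Multiset.replicate i g + Q ≤ U :=
    (add_le_add_left ((Multiset.replicate_le_replicate g).mpr hin) Q).trans hle
  have := hU.eq_zero_of_card_lt hle' (by simpa using h0) (by simp; omega)
  have hcard : i = 0 ∧ Q = 0 := by simpa using congrArg Multiset.card this
  exact hiQ.elim (· hcard.1) (· hcard.2)

lemma mem_of_eq_replicate_add (hU : IsLongestMinZeroSum U) (hc : 6 ≤ U.card)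
    (hL : lengthSet (U + negSeq U) ⊆ {2, 4, U.card}) {Z R : Multiset G}
    (hUZ : U = Multiset.replicate 2 g + (Multiset.replicate 2 k + Z)) (hgk : g ≠ k)
    (hk : 3 • g + k = 0) (hR : R ≤ Z) (hRc : R.card = U.card - 6) : k ∈ R := by
  obtain ⟨i, hi, Q, hQ, h0, hiQ⟩ :=
    hU.davenportLE.exists_nsmul_add_sum_eq_zero g (m := 6) (R := R) (by omega)
  have hQc := Multiset.card_le_card hQ
  refine Multiset.mem_of_le hQ ?_
  have hk_eq : k = -(3 • g) := eq_neg_of_add_eq_zero_right hk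
  have hle {j : ℕ} (hj : j ≤ 2) : Multiset.replicate j g + Q ≤ U := by
    rw [hUZ]
    exact add_le_add ((Multiset.replicate_le_replicate g).mpr hj)
      ((hQ.trans hR).trans (Multiset.le_add_left _ _))
  have hkk : Multiset.replicate 2 k ≤ U := by
    rw [hUZ, add_left_comm]
    exact Multiset.le_add_right _ _
  have hkU : {k} ≤ U := ((Multiset.replicate_le_replicate k).mpr one_le_two).trans hkk
  have hi3 : 3 ≤ i := hU.lt_of_nsmul_add_sum_eq_zero (hle le_rfl) (by omega) h0 hiQ
  obtain ⟨j, rfl⟩ := Nat.exists_eq_add_of_le hi3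
  obtain hj | rfl : j ≤ 2 ∨ j = 3 := by omega
  · have hQk : Multiset.replicate j g + Q = {k} :=
      eq_of_sum_eq_of_card_lt hU.toIsMinZeroSum hc hL (hle hj) hkU
        (by
          simp only [Multiset.sum_add, Multiset.sum_replicate, Multiset.sum_singleton, hk_eq]
          rw [eq_neg_iff_add_eq_zero, ← h0, add_nsmul]
          abel)
        (by simp; omega)
    have hmem : k ∈ Multiset.replicate j g + Q := by simp [hQk]
    exact (Multiset.mem_add.mp hmem).resolve_left fun h ↦ hgk (Multiset.eq_of_mem_replicate h).symm
  · have hQkk : Q = Multiset.replicate 2 k :=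
      eq_of_sum_eq_of_card_lt hU.toIsMinZeroSum hc hL (by simpa using hle (Nat.zero_le 2)) hkk
        (by
          rw [Multiset.sum_replicate, hk_eq, smul_neg, ← mul_nsmul, eq_neg_iff_add_eq_zero,
            add_comm]
          exact h0)
        (by simp; omega)
    simp [hQkk]

lemma ne_and_ne_of_add_eq_add {l l' m m' : G} (hlm : l ≠ m) (hlm' : l ≠ m')
    (h : l + l' = m + m') : l' ≠ m ∧ l' ≠ m' :=
  ⟨fun he ↦ hlm' (add_right_cancel (h.trans (by rw [he, add_comm]))),
    fun he ↦ hlm (add_right_cancel (h.trans (by rw [he])))⟩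

section Count

variable [DecidableEq G]

lemma count_le_three (hU : IsLongestMinZeroSum U) (hc : 6 ≤ U.card)
    (hL : lengthSet (U + negSeq U) ⊆ {2, 4, U.card}) (hne : ∀ g, ∃ h ∈ U, h ≠ g) (g : G) :
    U.count g ≤ 3 := by
  by_contra! hlt
  have hgg : g + g ≠ 0 := fun h0 ↦ by
    have := hU.count_le_one (by omega) h0
    omega
  obtain ⟨h, hh, hhg⟩ := hne g
  obtain ⟨l, l', Y, hUY, hgY, -, -⟩ :=
    exists_eq_cons_cons_cons hU hc hL (Multiset.count_pos.mp (by omega)) hh hhg.symm hgg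
  simp only [hUY, Multiset.count_cons, Multiset.count_eq_zero.mpr hgY] at hlt
  split_ifs at hlt <;> omega

lemma exists_eq_cons_cons_cons_of_count_eq_two (hU : IsLongestMinZeroSum U) (hc : 6 ≤ U.card)
    (hL : lengthSet (U + negSeq U) ⊆ {2, 4, U.card}) (hg : U.count g = 2) (hh : h ∈ U)
    (hgh : g ≠ h) :
    ∃ k Y, U = g ::ₘ g ::ₘ k ::ₘ Y ∧ g ≠ k ∧ g ∉ Y ∧ h ∈ Y ∧ 3 • g + k = 0 := by
  have hgg : g + g ≠ 0 := fun h0 ↦ by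
    have := hU.count_le_one (by omega) h0
    omega
  obtain ⟨l, l', Y, hUY, hgY, hhY, hs⟩ :=
    exists_eq_cons_cons_cons hU hc hL (Multiset.count_pos.mp (by omega)) hh hgh hgg
  simp only [hUY, Multiset.count_cons, Multiset.count_eq_zero.mpr hgY] at hg
  by_cases hl : g = l
  · subst hl
    refine ⟨l', Y, hUY, ?_, hgY, hhY, by rw [← hs]; abel⟩
    rintro rfl
    simp at hg
  · obtain rfl : g = l' := by
      by_contra hl'
      simp [hl, hl'] at hg
    exact ⟨l, Y, by rw [hUY, Multiset.cons_swap l g], hl, hgY, hhY, by rw [← hs]; abel⟩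

lemma exists_eq_of_count_eq_two (hU : IsLongestMinZeroSum U) (hc : 6 ≤ U.card)
    (hL : lengthSet (U + negSeq U) ⊆ {2, 4, U.card}) (hne : ∀ g, ∃ h ∈ U, h ≠ g)
    (hg : U.count g = 2) :
    ∃ k Z, U = Multiset.replicate 2 g + (Multiset.replicate 2 k + Z) ∧ g ≠ k ∧ 3 • g + k = 0 := by
  obtain ⟨h, hh, hhg⟩ := hne g
  obtain ⟨k, Y, hUY, hgk, -, -, hk⟩ :=
    exists_eq_cons_cons_cons_of_count_eq_two hU hc hL hg hh hhg.symm
  have hkU : k ∈ U := by simp [hUY]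
  obtain ⟨k', Y', hUY', -, -, hkY', hk'⟩ :=
    exists_eq_cons_cons_cons_of_count_eq_two hU hc hL hg hkU hgk
  obtain rfl : k = k' := add_left_cancel (hk.trans hk'.symm)
  obtain ⟨Z, rfl⟩ := Multiset.exists_cons_of_mem hkY'
  refine ⟨k, Z, hUY'.trans ?_, hgk, hk⟩
  simp only [Multiset.replicate_succ, Multiset.replicate_zero, Multiset.cons_add, zero_add]

lemma count_ne_two (hU : IsLongestMinZeroSum U) (hc : 6 ≤ U.card)
    (hL : lengthSet (U + negSeq U) ⊆ {2, 4, U.card}) (hne : ∀ g, ∃ h ∈ U, h ≠ g) (g : G) :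
    U.count g ≠ 2 := by
  intro hg
  obtain ⟨k, Z, hUZ, hgk, hk⟩ := exists_eq_of_count_eq_two hU hc hL hne hg
  have hk3 := count_le_three hU hc hL hne k
  have hUc := congrArg Multiset.card hUZ
  simp only [Multiset.card_add, Multiset.card_replicate] at hUc
  rw [hUZ, Multiset.count_add, Multiset.count_add, Multiset.count_replicate_self] at hk3
  have hkZ : k ∉ Z.erase k := by
    rw [← Multiset.count_eq_zero, Multiset.count_erase_self]
    omega
  have hZc := Multiset.card_le_card (Multiset.le_cons_erase Z k)
  rw [Multiset.card_cons] at hZc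
  obtain ⟨R, hR, hRc⟩ : ∃ R ≤ Z.erase k, R.card = U.card - 6 := by
    have hpos : 0 < (Z.erase k).card.choose (U.card - 6) := Nat.choose_pos (by omega)
    rw [← Multiset.card_powersetCard] at hpos
    obtain ⟨R, hR⟩ := Multiset.card_pos_iff_exists_mem.mp hpos
    exact ⟨R, Multiset.mem_powersetCard.mp hR⟩
  exact hkZ (Multiset.mem_of_le hR
    (mem_of_eq_replicate_add hU hc hL hUZ hgk hk (hR.trans (Multiset.erase_le _ _)) hRc))

lemma four_nsmul_eq_zero_of_count_eq_three (hU : IsLongestMinZeroSum U) (hc : 6 ≤ U.card)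
    (hL : lengthSet (U + negSeq U) ⊆ {2, 4, U.card}) (hne : ∀ g, ∃ h ∈ U, h ≠ g)
    (hg : U.count g = 3) : 4 • g = 0 := by
  obtain ⟨h, hh, hhg⟩ := hne g
  have hgg : g + g ≠ 0 := fun h0 ↦ by
    have := hU.count_le_one (by omega) h0
    omega
  obtain ⟨l, l', Y, hUY, hgY, -, hs⟩ :=
    exists_eq_cons_cons_cons hU hc hL (Multiset.count_pos.mp (by omega)) hh hhg.symm hgg
  simp only [hUY, Multiset.count_cons, Multiset.count_eq_zero.mpr hgY] at hg
  obtain ⟨rfl, rfl⟩ : g = l ∧ g = l' := by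
    split_ifs at hg <;> first | omega | exact ⟨‹_›, ‹_›⟩
  rw [← hs]
  abel

-- If `U = g³h³R`, then `4g = 4h = 0` makes `R` and `gh` a relation that is too short.
lemma eq_of_count_eq_three (hU : IsLongestMinZeroSum U) (hc : 6 ≤ U.card)
    (hL : lengthSet (U + negSeq U) ⊆ {2, 4, U.card}) (hne : ∀ g, ∃ h ∈ U, h ≠ g)
    (hg : U.count g = 3) (hh : U.count h = 3) : g = h := by
  by_contra hgh
  have h4g := four_nsmul_eq_zero_of_count_eq_three hU hc hL hne hg
  have h4h := four_nsmul_eq_zero_of_count_eq_three hU hc hL hne hh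
  have hd : Disjoint (Multiset.replicate 3 g) (Multiset.replicate 3 h) := by
    rw [Multiset.disjoint_left]
    intro x hx hx'
    rw [Multiset.mem_replicate] at hx hx'
    exact hgh (hx.2.symm.trans hx'.2)
  obtain ⟨R, hR⟩ := Multiset.le_iff_exists_add.mp (add_le_of_disjoint
    (Multiset.le_count_iff_replicate_le.mp hg.ge) (Multiset.le_count_iff_replicate_le.mp hh.ge) hd)
  have hgR : g ∉ R := by
    rw [hR, Multiset.count_add, Multiset.count_add, Multiset.count_replicate_self] at hg
    exact Multiset.count_eq_zero.mp (by omega)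
  have hRc := congrArg Multiset.card hR
  simp only [Multiset.card_add, Multiset.card_replicate] at hRc
  have hsum : R.sum = ({g, h} : Multiset G).sum := by
    have h0 := hU.sum_eq_zero
    rw [hR, Multiset.sum_add, Multiset.sum_add, Multiset.sum_replicate, Multiset.sum_replicate,
      ← add_right_inj (g + h), add_zero] at h0
    calc R.sum = 4 • g + 4 • h + R.sum := by rw [h4g, h4h, add_zero, zero_add]
      _ = g + h + (3 • g + 3 • h + R.sum) := by abel
      _ = ({g, h} : Multiset G).sum := by simpa using h0
  have hRgh : R = {g, h} := eq_of_sum_eq_of_card_lt hU.toIsMinZeroSum hc hL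
    (by rw [hR]; exact Multiset.le_add_left _ _)
    (pair_le_of_ne hgh (Multiset.count_pos.mp (by omega)) (Multiset.count_pos.mp (by omega)))
    hsum (by rw [Multiset.card_pair]; omega)
  exact hgR (by simp [hRgh])

lemma count_eq_three_of_two_le_count (hU : IsLongestMinZeroSum U) (hc : 6 ≤ U.card)
    (hL : lengthSet (U + negSeq U) ⊆ {2, 4, U.card}) (hne : ∀ g, ∃ h ∈ U, h ≠ g)
    (hg : 2 ≤ U.count g) : U.count g = 3 := by
  have := count_le_three hU hc hL hne g
  have := count_ne_two hU hc hL hne g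
  omega

lemma eq_of_two_le_count (hU : IsLongestMinZeroSum U) (hc : 6 ≤ U.card)
    (hL : lengthSet (U + negSeq U) ⊆ {2, 4, U.card}) (hne : ∀ g, ∃ h ∈ U, h ≠ g)
    (hg : 2 ≤ U.count g) (hh : 2 ≤ U.count h) : g = h :=
  eq_of_count_eq_three hU hc hL hne (count_eq_three_of_two_le_count hU hc hL hne hg)
    (count_eq_three_of_two_le_count hU hc hL hne hh)

lemma exists_eq_cons_cons_cons_of_count_eq_one (hU : IsLongestMinZeroSum U) (hc : 6 ≤ U.card)
    (hL : lengthSet (U + negSeq U) ⊆ {2, 4, U.card}) (hne : ∀ g, ∃ h ∈ U, h ≠ g)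
    (hg : U.count g = 1) (hgg : g + g ≠ 0) :
    ∃ l l' Y, U = g ::ₘ l ::ₘ l' ::ₘ Y ∧ g + g + (l + l') = 0 ∧ (l = l' ∨ U.count l = 1) := by
  obtain ⟨h, hh, hhg⟩ := hne g
  obtain ⟨l, l', Y, hUY, -, -, hs⟩ :=
    exists_eq_cons_cons_cons hU hc hL (Multiset.count_pos.mp (by omega)) hh hhg.symm hgg
  by_cases hll : l = l'
  · exact ⟨l, l', Y, hUY, hs, .inl hll⟩
  have hl : 1 ≤ U.count l := Multiset.one_le_count_iff_mem.mpr (by simp [hUY])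
  have hl' : 1 ≤ U.count l' := Multiset.one_le_count_iff_mem.mpr (by simp [hUY])
  by_cases hl1 : U.count l = 1
  · exact ⟨l, l', Y, hUY, hs, .inr hl1⟩
  · refine ⟨l', l, Y, hUY.trans (by rw [Multiset.cons_swap l]), add_comm l l' ▸ hs, .inr ?_⟩
    by_contra hl1'
    exact hll (eq_of_two_le_count hU hc hL hne (by omega) (by omega))

lemma exists_two_le_count_or_nodup_le (hU : IsLongestMinZeroSum U) (hc : 6 ≤ U.card)
    (hL : lengthSet (U + negSeq U) ⊆ {2, 4, U.card}) (hne : ∀ g, ∃ h ∈ U, h ≠ g)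
    (hg : U.count g = 1) (hgg : g + g ≠ 0) :
    (∃ m, 2 ≤ U.count m ∧ g + g + (m + m) = 0) ∨
      ∃ l l' m m', ({g, l, l', m, m'} : Multiset G).Nodup ∧ {g, l, l', m, m'} ≤ U ∧
        g + g + (l + l') = 0 ∧ g + g + (m + m') = 0 := by
  obtain ⟨l, l', Y, hUY, hl, hl1⟩ := exists_eq_cons_cons_cons_of_count_eq_one hU hc hL hne hg hgg
  obtain ⟨hgl, hgl', -⟩ : g ≠ l ∧ g ≠ l' ∧ g ∉ Y := by
    simpa only [Multiset.mem_cons, not_or] using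
      notMem_of_count_cons_eq_one (S := l ::ₘ l' ::ₘ Y) (hUY ▸ hg)
  obtain rfl | hll := eq_or_ne l l'
  · exact .inl ⟨l, by simp [hUY, hgl.symm], hl⟩
  have hlU : l ∈ U := by simp [hUY]
  have hl'U : l' ∈ U := by simp [hUY]
  obtain ⟨m, m', Z, hUZ, -, hlZ, hm⟩ :=
    exists_eq_cons_cons_cons hU hc hL (Multiset.count_pos.mp (by omega)) hlU hgl hgg
  obtain ⟨hgm, hgm', -⟩ : g ≠ m ∧ g ≠ m' ∧ g ∉ Z := by
    simpa only [Multiset.mem_cons, not_or] using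
      notMem_of_count_cons_eq_one (S := m ::ₘ m' ::ₘ Z) (hUZ ▸ hg)
  obtain rfl | hmm := eq_or_ne m m'
  · exact .inl ⟨m, by simp [hUZ, hgm.symm], hm⟩
  have hmU : m ∈ U := by simp [hUZ]
  have hm'U : m' ∈ U := by simp [hUZ]
  obtain ⟨Z, rfl⟩ := Multiset.exists_cons_of_mem hlZ
  obtain ⟨-, hlm, hlm', -⟩ : l ≠ g ∧ l ≠ m ∧ l ≠ m' ∧ l ∉ Z := by
    rw [Multiset.cons_swap m' l, Multiset.cons_swap m l, Multiset.cons_swap g l] at hUZ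
    simpa only [Multiset.mem_cons, not_or] using
      notMem_of_count_cons_eq_one (S := g ::ₘ m ::ₘ m' ::ₘ Z) (hUZ ▸ hl1.resolve_left hll)
  have hsum : l + l' = m + m' := add_left_cancel (hl.trans hm.symm)
  obtain ⟨hl'm, hl'm'⟩ := ne_and_ne_of_add_eq_add hlm hlm' hsum
  have hnodup : ({g, l, l', m, m'} : Multiset G).Nodup := by
    simp [hgl, hgl', hgm, hgm', hll, hlm, hlm', hl'm, hl'm', hmm]
  refine .inr ⟨l, l', m, m', hnodup, (Multiset.le_iff_subset hnodup).mpr ?_, hl, hm⟩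
  simp only [Multiset.insert_eq_cons, Multiset.cons_subset, Multiset.singleton_subset]
  exact ⟨Multiset.count_pos.mp (by omega), hlU, hl'U, hmU, hm'U⟩

end Count

lemma card_eq_six_of_nodup (hU : IsMinZeroSum U) (hc : 6 ≤ U.card)
    (hL : lengthSet (U + negSeq U) ⊆ {2, 4, U.card}) {l l' m m' : G}
    (hn : ({l, l', m, m'} : Multiset G).Nodup) (hle : {l, l', m, m'} ≤ U)
    (hsum : l + l' = m + m') : U.card = 6 := by
  by_contra hc6
  have hlU : ({l, l'} : Multiset G) ≤ {l, l', m, m'} := by simp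
  have hmU : ({m, m'} : Multiset G) ≤ {l, l', m, m'} :=
    (Multiset.le_cons_self _ l').trans (Multiset.le_cons_self _ l)
  have hpairs : ({l, l'} : Multiset G) = {m, m'} :=
    eq_of_sum_eq_of_card_lt hU hc hL (hlU.trans hle) (hmU.trans hle) (by simpa using hsum)
      (by simp only [Multiset.card_pair]; omega)
  have hmem : l ∈ ({m, m'} : Multiset G) := by simp [← hpairs]
  simp at hn hmem
  tauto

lemma eq_add_add_of_eq {l l' m m' f : G} (hU : ({g, l, l', m, m'} + {f} : Multiset G).sum = 0)
    (hl : g + g + (l + l') = 0) (hm : g + g + (m + m') = 0) : f = g + g + g := by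
  have hU' : g + g + (l + l') + (g + g + (m + m')) + (f - (g + g + g)) = 0 := by
    rw [← hU]
    simp only [Multiset.insert_eq_cons, Multiset.sum_add, Multiset.sum_cons,
      Multiset.sum_singleton]
    abel
  rwa [hl, hm, zero_add, zero_add, sub_eq_zero] at hU'

lemma nsmul_ne_zero_of_card_eq_six {l l' m m' : G} (hU : IsMinZeroSum U) (hc : U.card = 6)
    (hL : lengthSet (U + negSeq U) ⊆ {2, 4, U.card}) (hUf : U = {g, l, l', m, m'} + {g + g + g})
    (hgg : g + g ≠ 0) (hl : g + g + (l + l') = 0) {i : ℕ} (hi : 0 < i) (hi6 : i < 6) :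
    i • g ≠ 0 := by
  have h0 := hU.zero_notMem (by omega)
  have hgU : g ∈ U := by simp [hUf]
  have hfU : g + g + g ∈ U := by simp [hUf]
  have hgf : g ≠ g + g + g := by rwa [Ne, add_assoc, left_eq_add]
  interval_cases i
  · rw [one_nsmul]
    exact fun h ↦ h0 (h ▸ hgU)
  · rwa [two_nsmul]
  · rw [show 3 • g = g + g + g by abel]
    exact fun h ↦ h0 (h ▸ hfU)
  · rw [show 4 • g = g + (g + g + g) by abel]
    exact hU.add_ne_zero (by omega) (pair_le_of_ne hgf hgU hfU)
  · intro h
    have hpair : ({l, l'} : Multiset G) ≤ U :=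
      le_trans (by simp) ((Multiset.le_cons_self _ g).trans (hUf ▸ Multiset.le_add_right _ _))
    have hsum : g + g + g = l + l' := by
      refine add_left_cancel (a := g + g) (Eq.trans ?_ hl.symm)
      rw [← h]
      abel
    have := eq_of_sum_eq_of_card_lt hU hc.ge hL (Multiset.singleton_le.mpr hfU) hpair
      (by simpa using hsum) (by simp [hc])
    simpa using congrArg Multiset.card this

-- Here `U = g l l' m m' (3g)`, so `g` has order six and generates `G`, which is too small.
lemma not_nodup_of_card_eq_six (hU : IsLongestMinZeroSum U) (hc : U.card = 6)
    (hL : lengthSet (U + negSeq U) ⊆ {2, 4, U.card}) {l l' m m' : G}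
    (hle : {g, l, l', m, m'} ≤ U) (hgg : g + g ≠ 0)
    (hl : g + g + (l + l') = 0) (hm : g + g + (m + m') = 0) : ¬ U.Nodup := by
  intro hn
  have := hU.finite
  obtain ⟨f, hf⟩ := exists_eq_add_singleton hle (by simp [hc])
  obtain rfl := eq_add_add_of_eq (hf ▸ hU.sum_eq_zero) hl hm
  have hord : addOrderOf g = 6 := by
    refine le_antisymm (hc ▸ hU.davenportLE.addOrderOf_le g) ?_
    by_contra! hlt
    exact nsmul_ne_zero_of_card_eq_six hU.toIsMinZeroSum hc hL hf hgg hl (addOrderOf_pos g) hlt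
      (addOrderOf_nsmul_eq_zero g)
  have hcard : addOrderOf g = Nat.card G := addOrderOf_eq_card_of_forall_mem_zmultiples
    (DavenportLE.mem_zmultiples (by rw [hord, ← hc]; exact hU.davenportLE))
  have := card_lt_natCard hn (hU.zero_notMem (by omega))
  omega

lemma exists_two_le_count [DecidableEq G] (hU : IsLongestMinZeroSum U) (hc : 6 ≤ U.card)
    (hL : lengthSet (U + negSeq U) ⊆ {2, 4, U.card}) (hne : ∀ g, ∃ h ∈ U, h ≠ g)
    (hg : g ∈ U) (hgg : g + g ≠ 0) : ∃ q, 2 ≤ U.count q := by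
  by_contra! hlt
  have hn : U.Nodup := Multiset.nodup_iff_count_le_one.mpr fun x ↦ Nat.le_of_lt_succ (hlt x)
  rcases exists_two_le_count_or_nodup_le hU hc hL hne
    (Multiset.count_eq_one_of_mem hn hg) hgg with ⟨m, hm, -⟩ | ⟨l, l', m, m', hn', hle, hl, hm⟩
  · exact (hlt m).not_ge hm
  · have hc6 := card_eq_six_of_nodup hU.toIsMinZeroSum hc hL (Multiset.nodup_cons.mp hn').2
      ((Multiset.le_cons_self _ g).trans hle) (add_left_cancel (hl.trans hm.symm))
    exact not_nodup_of_card_eq_six hU hc6 hL hle hgg hl hm hn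

lemma add_self_eq_zero_or_eq [DecidableEq G] {q : G} (hU : IsLongestMinZeroSum U)
    (hc : 6 ≤ U.card) (hL : lengthSet (U + negSeq U) ⊆ {2, 4, U.card})
    (hne : ∀ g, ∃ h ∈ U, h ≠ g) (hq : U.count q = 3) (hg : g ∈ U) :
    g + g = 0 ∨ g + g = q + q := by
  obtain rfl | hgq := eq_or_ne g q
  · exact .inr rfl
  rw [or_iff_not_imp_left]
  intro hgg
  have hg1 : U.count g = 1 := by
    refine le_antisymm ?_ (Multiset.one_le_count_iff_mem.mpr hg)
    by_contra! hlt
    exact hgq (eq_of_two_le_count hU hc hL hne hlt (by omega))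
  rcases exists_two_le_count_or_nodup_le hU hc hL hne hg1 hgg with
    ⟨m, hm, hgm⟩ | ⟨l, l', m, m', hn, hle, hl, hm⟩
  · obtain rfl : m = q := eq_of_two_le_count hU hc hL hne hm (by omega)
    refine add_right_cancel (b := m + m) (hgm.trans ?_)
    rw [← four_nsmul_eq_zero_of_count_eq_three hU hc hL hne hq]
    abel
  · have hc6 := card_eq_six_of_nodup hU.toIsMinZeroSum hc hL (Multiset.nodup_cons.mp hn).2
      ((Multiset.le_cons_self _ g).trans hle) (add_left_cancel (hl.trans hm.symm))
    obtain ⟨f, hf⟩ := exists_eq_add_singleton hle (by simp [hc6])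
    have h1 := Multiset.nodup_iff_count_le_one.mp hn q
    have h2 := Multiset.nodup_iff_count_le_one.mp (Multiset.nodup_singleton f) q
    rw [hf, Multiset.count_add] at hq
    omega

theorem IsLongestMinZeroSum.exists_two_nsmul (hU : IsLongestMinZeroSum U) (hc : 6 ≤ U.card)
    (hL : lengthSet (U + negSeq U) = {2, 4, U.card}) :
    ∃ q : G, q + q ≠ 0 ∧ 4 • q = 0 ∧ ∀ x : G, x + x = 0 ∨ x + x = q + q := by
  classical
  have h4 : 4 ∈ lengthSet (U + negSeq U) := by simp [hL]
  have hU' := hU.toIsMinZeroSum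
  have hne := exists_mem_ne hU' h4 (by omega) (by omega)
  obtain ⟨g, hg, hgg⟩ := exists_add_self_ne_zero hU' h4 (by omega) (by omega)
  obtain ⟨q, hq2⟩ := exists_two_le_count hU hc hL.subset hne hg hgg
  have hq := count_eq_three_of_two_le_count hU hc hL.subset hne hq2
  have hq4 := four_nsmul_eq_zero_of_count_eq_three hU hc hL.subset hne hq
  refine ⟨q, fun h ↦ by have := hU'.count_le_one (by omega) h; omega, hq4, fun x ↦ ?_⟩
  have hmem := hU.mem_of_forall_mem
    (K := (AddSubgroup.zmultiples (q + q)).comap (nsmulAddMonoidHom 2)) (fun y hy ↦ ?_) x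
  · rw [← two_nsmul]
    exact eq_zero_or_eq_of_mem_zmultiples (by rw [← hq4]; abel) hmem
  · rw [AddSubgroup.mem_comap, nsmulAddMonoidHom_apply, two_nsmul]
    rcases add_self_eq_zero_or_eq hU hc hL.subset hne hq hy with h | h <;> rw [h]
    exacts [zero_mem _, AddSubgroup.mem_zmultiples _]

end LargeRank


section Structure

variable {G : Type*} [AddCommGroup G] {p : ℕ} [Fact p.Prime]

lemma exists_isCompl_of_forall_nsmul_eq_zero (hG : ∀ x : G, p • x = 0) (H : AddSubgroup G) :
    ∃ K : AddSubgroup G, IsCompl H K := by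
  let _ : Module (ZMod p) G := AddCommGroup.zmodModule hG
  obtain ⟨K, hK⟩ := (AddSubgroup.toZModSubmodule p H).exists_isCompl
  exact ⟨K.toAddSubgroup, (AddSubgroup.toZModSubmodule p).isCompl_iff.mpr hK⟩

lemma exists_disjoint_sup_eq {H T : AddSubgroup G}
    (hT : ∀ x ∈ T, p • x = 0) (hHT : H ≤ T) : ∃ K ≤ T, Disjoint H K ∧ H ⊔ K = T := by
  obtain ⟨K, hK⟩ := exists_isCompl_of_forall_nsmul_eq_zero
    (fun x : T ↦ Subtype.ext (by simpa using hT x x.2)) (H.addSubgroupOf T)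
  have hH : (H.addSubgroupOf T).map T.subtype = H := by
    rw [AddSubgroup.addSubgroupOf_map_subtype, inf_eq_left.mpr hHT]
  refine ⟨K.map T.subtype, AddSubgroup.map_subtype_le K, ?_, ?_⟩
  · rw [← hH]
    exact AddSubgroup.disjoint_map T.subtype_injective hK.disjoint
  · rw [← hH, ← AddSubgroup.map_sup, hK.sup_eq_top, ← AddMonoidHom.range_eq_map,
      AddSubgroup.range_subtype]

lemma exists_addEquiv_pi_zmod_two [Finite G] (hG : ∀ x : G, x + x = 0) :
    ∃ b : ℕ, Nonempty (G ≃+ (Fin b → ZMod 2)) := by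
  let _ : Module (ZMod 2) G := AddCommGroup.zmodModule (by simpa only [two_nsmul] using hG)
  have : Module.Finite (ZMod 2) G := Module.Finite.of_finite
  exact ⟨_, ⟨(Module.finBasis (ZMod 2) G).equivFun.toAddEquiv⟩⟩

lemma exists_addEquiv_pi_zmod_two_prod_zmod_four [Finite G] {q : G} (hq : q + q ≠ 0)
    (hq4 : 4 • q = 0) (hG : ∀ x : G, x + x = 0 ∨ x + x = q + q) :
    ∃ b : ℕ, Nonempty (G ≃+ (Fin b → ZMod 2) × ZMod 4) := by
  have h2q : q + q + (q + q) = 0 := by rw [← hq4]; abel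
  obtain ⟨K, hKT, hdisj, hsup⟩ := exists_disjoint_sup_eq (p := 2) (H := .zmultiples (q + q))
    (T := (nsmulAddMonoidHom 2).ker) (fun x ↦ id) (by simp [two_nsmul, h2q])
  have hK2 : ∀ x ∈ K, x + x = 0 := fun x hx ↦ by simpa [two_nsmul] using hKT hx
  have hq2 : q + q ∉ K := fun h ↦
    hq (AddSubgroup.disjoint_def.mp hdisj (AddSubgroup.mem_zmultiples _) h)
  have hord : ∀ i, 0 < i → i < 4 → i • q ∉ K := by
    intro i hi hi4 h
    interval_cases i
    · exact hq (hK2 q (by simpa using h))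
    · exact hq2 (by rwa [two_nsmul] at h)
    · refine hq (Eq.trans ?_ (hK2 _ h))
      rw [← add_zero (q + q), ← h2q]
      abel
  have hle : K ⊔ .zmultiples (q + q) ≤ K ⊔ .zmultiples q :=
    sup_le_sup_left (by simp [add_mem]) K
  have hgen : ∀ x, x ∈ K ⊔ .zmultiples q := by
    intro x
    have hker : ∀ y, y + y = 0 → y ∈ K ⊔ .zmultiples q := fun y hy ↦
      hle (by rw [sup_comm, hsup]; simpa [two_nsmul] using hy)
    rcases hG x with hx | hx
    · exact hker x hx
    · rw [← sub_add_cancel x q]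
      exact add_mem (hker _ (by rw [sub_add_sub_comm, hx, sub_self]))
        (AddSubgroup.mem_sup_right (AddSubgroup.mem_zmultiples q))
  obtain ⟨f⟩ := nonempty_addEquiv_prod_zmod (by norm_num) hq4 hord hgen
  obtain ⟨b, ⟨e⟩⟩ := exists_addEquiv_pi_zmod_two fun x : K ↦ Subtype.ext (hK2 x x.2)
  exact ⟨b, ⟨f.trans (e.prodCongr (AddEquiv.refl _))⟩⟩

end Structure


section GroupAlgebra

variable {R G : Type*} [CommRing R] [AddCommGroup G]

open AddMonoidAlgebra in
lemma coeff_prod_one_sub_single {S : Multiset G} {x : G} (hS : ∀ T ≤ S, T.sum = x → T = 0) :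
    (S.map fun g ↦ (1 - single g 1 : AddMonoidAlgebra R G)).prod.coeff x =
      (1 : AddMonoidAlgebra R G).coeff x := by
  induction S using Multiset.induction_on generalizing x with
  | empty => simp
  | cons a S ih =>
    have hxa : -a + x ≠ 0 := by
      intro h
      simpa using hS {a} (by simp) (by simpa using neg_add_eq_zero.mp h)
    have hcons : ∀ T ≤ S, T.sum ≠ -a + x := by
      intro T hT hx
      simpa using hS (a ::ₘ T) ((Multiset.cons_le_cons_iff a).mpr hT) (by simp [hx])
    rw [Multiset.map_cons, Multiset.prod_cons, sub_mul, one_mul, coeff_sub, Finsupp.sub_apply,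
      coeff_single_mul_apply, ih fun T hT ↦ hS T (hT.trans (Multiset.le_cons_self _ _)),
      ih fun T hT hx ↦ absurd hx (hcons T hT)]
    simp [one_def, hxa.symm]

lemma IsZeroSumFree.prod_one_sub_single_ne_zero [Nontrivial R] {S : Multiset G}
    (hS : IsZeroSumFree S) :
    (S.map fun g ↦ (1 - .single g 1 : AddMonoidAlgebra R G)).prod ≠ 0 := by
  intro h
  have h0 := coeff_prod_one_sub_single (R := R) hS
  rw [h, AddMonoidAlgebra.one_def] at h0
  simp at h0

lemma sum_pow_eq_zero {ι A : Type*} [CommSemiring A] (s : Finset ι) {x : ι → A} {k : ι → ℕ}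
    (hx : ∀ i ∈ s, x i ^ (k i + 1) = 0) : (∑ i ∈ s, x i) ^ (∑ i ∈ s, k i + 1) = 0 := by
  classical
  induction s using Finset.induction_on with
  | empty => simp
  | insert a s ha ih =>
    rw [Finset.sum_insert ha, Finset.sum_insert ha]
    exact (Commute.all _ _).add_pow_eq_zero_of_add_le_succ_of_pow_eq_zero
      (hx a (Finset.mem_insert_self a s)) (ih fun i hi ↦ hx i (Finset.mem_insert_of_mem hi))
      (by omega)

lemma span_range_pow_eq_zero {ι A : Type*} [Fintype ι] [CommSemiring A] {x : ι → A}
    {k : ι → ℕ} (hx : ∀ i, x i ^ (k i + 1) = 0) :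
    Ideal.span (Set.range x) ^ (∑ i, k i + 1) = 0 := by
  have hspan : Ideal.span (Set.range x) = ∑ i, Ideal.span {x i} := by
    rw [Ideal.sum_eq_sup, Finset.sup_univ_eq_iSup]
    exact Submodule.span_range_eq_iSup
  rw [hspan]
  refine sum_pow_eq_zero _ fun i _ ↦ ?_
  rw [Ideal.span_singleton_pow, hx]
  simp

lemma prod_map_mem_pow {α A : Type*} [CommSemiring A] {J : Ideal A} {f : α → A}
    (hf : ∀ a, f a ∈ J) (S : Multiset α) : (S.map f).prod ∈ J ^ S.card := by
  induction S using Multiset.induction_on with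
  | empty => simp
  | cons a S ih =>
    rw [Multiset.map_cons, Multiset.prod_cons, Multiset.card_cons, pow_succ']
    exact Ideal.mul_mem_mul (hf a) ih

lemma one_sub_single_mem_of_mem_closure {J : Ideal (AddMonoidAlgebra R G)} {E : Set G}
    (hE : ∀ g ∈ E, 1 - .single g 1 ∈ J) {g : G} (hg : g ∈ AddSubgroup.closure E) :
    1 - .single g 1 ∈ J := by
  induction hg using AddSubgroup.closure_induction with
  | mem g hg => exact hE g hg
  | zero => simp [← AddMonoidAlgebra.one_def]
  | add g h _ _ hg hh =>
    convert! add_mem (J.mul_mem_left (.single h 1) hg) hh using 1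
    simp [mul_sub, AddMonoidAlgebra.single_mul_single, add_comm h g]
  | neg g _ hg =>
    convert! J.mul_mem_left (-.single (-g) 1) hg using 1
    simp [mul_sub, AddMonoidAlgebra.single_mul_single, ← AddMonoidAlgebra.one_def]
    abel

-- In characteristic `p` the elements `1 - X ^ g` generate a nilpotent ideal.
theorem davenportLE_of_closure_eq_top {p : ℕ} [Fact p.Prime] {ι : Type*} [Fintype ι]
    {e : ι → G} {n : ι → ℕ} (he : ∀ i, p ^ n i • e i = 0)
    (hgen : AddSubgroup.closure (Set.range e) = ⊤) :
    DavenportLE G (∑ i, (p ^ n i - 1) + 1) := by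
  have : CharP (AddMonoidAlgebra (ZMod p) G) p :=
    charP_of_injective_algebraMap (algebraMap (ZMod p) _).injective p
  let x : ι → AddMonoidAlgebra (ZMod p) G := fun i ↦ 1 - .single (e i) 1
  have hx : ∀ i, x i ^ (p ^ n i - 1 + 1) = 0 := by
    intro i
    rw [Nat.sub_add_cancel (Nat.one_le_pow _ _ (Fact.out : p.Prime).pos), sub_pow_char_pow,
      one_pow, AddMonoidAlgebra.single_pow, he i, one_pow, AddMonoidAlgebra.one_def, sub_self]
  have hmem : ∀ g, 1 - .single g 1 ∈ Ideal.span (Set.range x) := by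
    refine fun g ↦ one_sub_single_mem_of_mem_closure ?_ (hgen ▸ AddSubgroup.mem_top g)
    rintro _ ⟨i, rfl⟩
    exact Ideal.subset_span ⟨i, rfl⟩
  refine davenportLE_iff.mpr fun S hS hfree ↦ hfree.prod_one_sub_single_ne_zero (R := ZMod p) ?_
  simpa [span_range_pow_eq_zero hx] using
    Ideal.pow_le_pow_right hS (prod_map_mem_pow hmem S)

end GroupAlgebra

section Davenport

variable {G H : Type*} [AddCommGroup G] [AddCommGroup H]

/-- The basis element of `C₂ᵇ ⊕ C_m` generating the `i`-th summand `C₂`. -/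
def modelBasis (b m : ℕ) (i : Fin b) : (Fin b → ZMod 2) × ZMod m := (Pi.single i 1, 0)

lemma modelBasis_add_self {b m : ℕ} (i : Fin b) :
    modelBasis b m i + modelBasis b m i = 0 := by
  ext
  · exact CharTwo.add_self_eq_zero _
  · simp [modelBasis]

lemma sum_val_nsmul_modelBasis {b m : ℕ} [NeZero m] (g : (Fin b → ZMod 2) × ZMod m) :
    ∑ i, (g.1 i).val • modelBasis b m i + g.2.val • (0, 1) = g := by
  ext
  · simp [-nsmul_eq_mul, modelBasis, Prod.fst_sum, Pi.single_apply]
  · simp [modelBasis, Prod.snd_sum]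

lemma davenportLE_pi_zmod_two_prod_zmod_four (b : ℕ) :
    DavenportLE ((Fin b → ZMod 2) × ZMod 4) (b + 4) := by
  let e : Fin b ⊕ Unit → (Fin b → ZMod 2) × ZMod 4 :=
    Sum.elim (modelBasis b 4) fun _ ↦ (0, 1)
  have h := davenportLE_of_closure_eq_top (p := 2) (e := e)
    (n := Sum.elim (fun _ ↦ 1) fun _ ↦ 2) ?_ ?_
  · simpa using h
  · rintro (i | i)
    · change 2 ^ 1 • modelBasis b 4 i = 0
      rw [pow_one, two_nsmul, modelBasis_add_self]
    · change 2 ^ 2 • ((0, 1) : (Fin b → ZMod 2) × ZMod 4) = 0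
      ext
      · simp
      · exact (by decide : (2 ^ 2 • 1 : ZMod 4) = 0)
  · refine (AddSubgroup.eq_top_iff' _).mpr fun g ↦ ?_
    have he : ∀ i, e i ∈ AddSubgroup.closure (Set.range e) := fun i ↦
      AddSubgroup.subset_closure (Set.mem_range_self i)
    rw [← sum_val_nsmul_modelBasis g]
    exact add_mem (sum_mem fun i _ ↦ nsmul_mem (he (.inl i)) _) (nsmul_mem (he (.inr ())) _)

lemma davenportLE_zmod_two_prod_zmod_two : DavenportLE (ZMod 2 × ZMod 2) 3 := by
  let e : Fin 2 → ZMod 2 × ZMod 2 := ![(1, 0), (0, 1)]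
  have h := davenportLE_of_closure_eq_top (p := 2) (e := e) (n := fun _ ↦ 1) (by decide) ?_
  · simpa using h
  · refine (AddSubgroup.eq_top_iff' _).mpr fun g ↦ ?_
    have he : ∀ i, e i ∈ AddSubgroup.closure (Set.range e) := fun i ↦
      AddSubgroup.subset_closure (Set.mem_range_self i)
    have hg : g = g.1.val • e 0 + g.2.val • e 1 := by
      revert g
      decide
    rw [hg]
    exact add_mem (nsmul_mem (he 0) _) (nsmul_mem (he 1) _)

lemma davenportLE_natCard [Finite G] : DavenportLE G (Nat.card G) := by
  refine davenportLE_iff.mpr fun S hS hfree ↦ ?_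
  obtain ⟨l, rfl⟩ := Quot.exists_rep S
  have hinj : Function.Injective fun i : Fin (l.length + 1) ↦ (l.take i).sum := by
    refine Function.Injective.of_lt_imp_ne fun i j hij hsum ↦ ?_
    have hle : (((l.take j).drop i : List G) : Multiset G) ≤ (l : Multiset G) :=
      ((List.drop_sublist _ _).trans (List.take_sublist _ _)).subperm
    have hzero : ((l.take j).drop i).sum = 0 := by
      have h := (l.take j).sum_take_add_sum_drop i
      rw [List.take_take, min_eq_left (by omega), hsum] at h
      simpa using h
    have hlen := congrArg Multiset.card (hfree _ hle (by simpa using hzero))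
    simp at hlen
    omega
  have hcard := Nat.card_le_card_of_injective _ hinj
  rw [Nat.card_fin] at hcard
  exact absurd hS (by simpa using hcard)

lemma exists_le_map_eq {α β : Type*} {f : α → β} {S : Multiset α} {A : Multiset β}
    (h : A ≤ S.map f) : ∃ T ≤ S, T.map f = A := by
  classical
  induction S using Multiset.induction_on generalizing A with
  | empty => exact ⟨0, le_rfl, by simpa [eq_comm] using h.antisymm (Multiset.zero_le _)⟩
  | cons a S ih =>
    rw [Multiset.map_cons] at h
    by_cases ha : f a ∈ A
    · obtain ⟨B, rfl⟩ := Multiset.exists_cons_of_mem ha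
      obtain ⟨T, hT, rfl⟩ := ih ((Multiset.cons_le_cons_iff _).mp h)
      exact ⟨a ::ₘ T, (Multiset.cons_le_cons_iff _).mpr hT, by simp⟩
    · obtain ⟨T, hT, rfl⟩ := ih ((Multiset.le_cons_of_notMem ha).mp h)
      exact ⟨T, hT.trans (Multiset.le_cons_self _ _), rfl⟩

lemma exists_pair_le_of_card_lt {α β : Type*} [Finite β] (f : α → β) {S : Multiset α}
    (hS : Nat.card β < S.card) : ∃ x y, {x, y} ≤ S ∧ f x = f y := by
  obtain ⟨b, hb⟩ : ∃ b, {b, b} ≤ S.map f := by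
    by_contra! h
    have := Fintype.ofFinite β
    have hn := (Finset.mk (S.map f) (Multiset.nodup_iff_le.mpr h)).card_le_univ
    rw [Finset.card_mk, Multiset.card_map, ← Nat.card_eq_fintype_card] at hn
    omega
  obtain ⟨T, hT, hTb⟩ := exists_le_map_eq hb
  obtain ⟨x, y, rfl⟩ := Multiset.card_eq_two.mp (by simpa using congrArg Multiset.card hTb)
  have hmem : ∀ u ∈ ({x, y} : Multiset α), f u = b := fun u hu ↦ by
    have h := Multiset.mem_map_of_mem f hu
    rw [hTb] at h
    simpa using h
  exact ⟨x, y, hT, by rw [hmem x (by simp), hmem y (by simp)]⟩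

lemma DavenportLE.exists_sum_map_eq_zero {D : ℕ} (hH : DavenportLE H D) (f : G →+ H)
    {S : Multiset G} (hS : D ≤ S.card) : ∃ T ≤ S, T ≠ 0 ∧ f T.sum = 0 := by
  have := davenportLE_iff.mp hH (S.map f) (by simpa using hS)
  simp only [IsZeroSumFree, not_forall] at this
  obtain ⟨A, hA, hA0, hne⟩ := this
  obtain ⟨T, hT, rfl⟩ := exists_le_map_eq hA
  exact ⟨T, hT, by rintro rfl; exact hne rfl, by rwa [map_multiset_sum]⟩

lemma not_isZeroSumFree_sum_of_davenportLE_ker {D : ℕ} {f : G →+ H} (hD : DavenportLE f.ker D)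
    {z : Multiset (Multiset G)} (hz : D ≤ z.card) (hzf : ∀ W ∈ z, W ≠ 0 ∧ f W.sum = 0) :
    ¬ IsZeroSumFree z.sum := by
  intro hfree
  obtain ⟨T, hT⟩ : ∃ T : Multiset f.ker, T.map f.ker.subtype = z.map Multiset.sum :=
    CanLift.prf (z.map Multiset.sum) (by simpa using fun W hW ↦ (hzf W hW).2)
  have hTcard : T.card = z.card := by simpa using congrArg Multiset.card hT
  refine davenportLE_iff.mp hD T (hTcard ▸ hz) fun T' hT' hsum ↦ ?_
  obtain ⟨y, hy, hyT⟩ := exists_le_map_eq (hT ▸ Multiset.map_le_map hT')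
  have hy0 : y.sum = 0 := by
    refine hfree _ ?_ ?_
    · obtain ⟨w, rfl⟩ := Multiset.le_iff_exists_add.mp hy
      rw [Multiset.sum_add]
      exact Multiset.le_add_right _ _
    · calc
        y.sum.sum = (y.map Multiset.sum).sum := map_multiset_sum Multiset.sumAddMonoidHom y
        _ = 0 := by rw [hyT, ← map_multiset_sum, hsum, map_zero]
  obtain rfl : y = 0 := Multiset.eq_zero_of_forall_notMem fun W hW ↦
    (hzf W (Multiset.mem_of_le hy hW)).1
      (Multiset.le_zero.mp ((le_multiset_sum_of_mem hW).trans hy0.le))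
  simpa [eq_comm] using hyT

lemma exists_blocks_of_le_card (f : G →+ ZMod 2 × ZMod 2) (k : ℕ) {S : Multiset G}
    (hS : 2 * k + 1 ≤ S.card) :
    ∃ z : Multiset (Multiset G), z.card = k ∧ z.sum ≤ S ∧ ∀ W ∈ z, W ≠ 0 ∧ f W.sum = 0 := by
  induction k generalizing S with
  | zero => exact ⟨0, by simp⟩
  | succ k ih =>
    rcases Nat.eq_zero_or_pos k with rfl | hk
    · obtain ⟨T, hT, hT0⟩ := davenportLE_zmod_two_prod_zmod_two.exists_sum_map_eq_zero f hS
      exact ⟨{T}, by simp, by simpa using hT, by simpa using hT0⟩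
    · obtain ⟨x, y, hxy, hf⟩ := exists_pair_le_of_card_lt f (S := S)
        (by rw [Nat.card_prod, Nat.card_zmod]; omega)
      obtain ⟨R, rfl⟩ := Multiset.le_iff_exists_add.mp hxy
      rw [Multiset.card_add, Multiset.card_pair] at hS
      obtain ⟨z, hz, hzR, hzf⟩ := ih (S := R) (by omega)
      refine ⟨{x, y} ::ₘ z, by simp [hz], ?_, Multiset.forall_mem_cons.mpr ⟨⟨by simp, ?_⟩, hzf⟩⟩
      · rw [Multiset.sum_cons]
        exact add_le_add le_rfl hzR
      · rw [Multiset.insert_eq_cons, Multiset.sum_cons, Multiset.sum_singleton, map_add, hf]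
        exact (by decide : ∀ u : ZMod 2 × ZMod 2, u + u = 0) (f y)

theorem davenportLE_two_mul_card_ker_add_one (f : G →+ ZMod 2 × ZMod 2) [Finite f.ker] :
    DavenportLE G (2 * Nat.card f.ker + 1) := by
  refine davenportLE_iff.mpr fun S hS hfree ↦ ?_
  obtain ⟨z, hz, hzS, hzf⟩ := exists_blocks_of_le_card f _ hS
  exact not_isZeroSumFree_sum_of_davenportLE_ker davenportLE_natCard hz.ge hzf
    fun T hT ↦ hfree T (hT.trans hzS)

lemma davenportLE_zmod_two_prod_zmod {n : ℕ} (hn : 0 < n) :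
    DavenportLE (ZMod 2 × ZMod (2 * n)) (2 * n + 1) := by
  have : NeZero (2 * n) := ⟨by omega⟩
  let f : ZMod 2 × ZMod (2 * n) →+ ZMod 2 × ZMod 2 := AddMonoidHom.prodMap (.id _)
    (ZMod.castHom (dvd_mul_right 2 n) (ZMod 2)).toAddMonoidHom
  have hf : Function.Surjective f :=
    Function.surjective_id.prodMap (ZMod.castHom_surjective (dvd_mul_right 2 n))
  have hker : Nat.card f.ker * 4 = 2 * (2 * n) := by
    have h := f.ker.card_mul_index
    rw [AddSubgroup.index_ker, AddMonoidHom.range_eq_top.mpr hf, AddSubgroup.card_top] at h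
    simpa using h
  have := davenportLE_two_mul_card_ker_add_one f
  rwa [show Nat.card f.ker = n by omega] at this

end Davenport


section LengthCounting

variable {G : Type*} [AddCommGroup G] [DecidableEq G] {e : G} {t : ℕ}

lemma count_negSeq (U : Multiset G) (g : G) : (negSeq U).count g = U.count (-g) := by
  rw [negSeq, ← Multiset.count_map_eq_count' _ _ neg_injective, Multiset.map_map]
  simp

lemma exists_card_count_sum_eq (he : e + e = 0) {z : Multiset (Multiset G)}
    (hz : ∀ W ∈ z, W.sum = 0 ∧ (W.card = 2 ∨ W.card = t ∧ W.count e = 1)) :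
    ∃ i j p, z.card = j + p ∧ z.sum.card = 2 * j + t * p ∧ z.sum.count e = 2 * i + p := by
  induction z using Multiset.induction_on with
  | empty => exact ⟨0, 0, 0, by simp⟩
  | cons W z ih =>
    obtain ⟨i, j, p, h1, h2, h3⟩ := ih fun V hV ↦ hz V (Multiset.mem_cons_of_mem hV)
    simp only [Multiset.card_cons, Multiset.sum_cons, Multiset.card_add, Multiset.count_add,
      h1, h2, h3]
    obtain ⟨hW0, hW | ⟨hW, hWe⟩⟩ := hz W (Multiset.mem_cons_self W z)
    · obtain ⟨x, rfl⟩ := eq_pair_of_sum_eq_zero hW0 hW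
      by_cases hx : e = x
      · subst hx
        refine ⟨i + 1, j + 1, p, by omega, by rw [hW]; ring, ?_⟩
        rw [neg_eq_of_add_eq_zero_left he]
        simp
        ring
      · refine ⟨i, j + 1, p, by omega, by rw [hW]; ring, ?_⟩
        have hx' : e ≠ -x := fun h ↦ hx (by rw [← neg_eq_of_add_eq_zero_left he, h, neg_neg])
        simp [hx, hx']
    · exact ⟨i, j, p + 1, by omega, by rw [hW]; ring, by rw [hWe]; ring⟩

lemma IsMinZeroSum.eq_of_mem_lengthSet_add_negSeq {U : Multiset G} (hU : IsMinZeroSum U)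
    (he : e + e = 0) (heU : U.count e = 1)
    (hW : ∀ W ≤ U + negSeq U, IsMinZeroSum W →
      W.card = 2 ∨ W = U ∨ W = negSeq U ∨ W.card = t ∧ W.count e = 1)
    {k : ℕ} (hk : k ∈ lengthSet (U + negSeq U)) :
    k = 2 ∨ k = U.card ∨ k + t = U.card + 2 := by
  obtain ⟨z, hz, rfl⟩ := hk
  by_cases h1 : U ∈ z
  · exact .inl (hz.card_eq_two_of_mem hU.neg h1)
  by_cases h2 : negSeq U ∈ z
  · exact .inl ((add_comm U (negSeq U) ▸ hz).card_eq_two_of_mem hU h2)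
  obtain ⟨i, j, p, h3, h4, h5⟩ := exists_card_count_sum_eq (t := t) he fun W hWz ↦ by
    refine ⟨(hz.isMinZeroSum W hWz).sum_eq_zero, ?_⟩
    rcases hW W (hz.le_of_mem hWz) (hz.isMinZeroSum W hWz) with h | rfl | rfl | h
    · exact .inl h
    · exact absurd hWz h1
    · exact absurd hWz h2
    · exact .inr h
  have hcount : (negSeq U).count e = 1 := by
    rw [count_negSeq, neg_eq_of_add_eq_zero_left he, heU]
  rw [hz.sum_eq, Multiset.count_add, heU, hcount] at h5
  rw [hz.sum_eq, Multiset.card_add, card_negSeq] at h4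
  obtain rfl | rfl : p = 0 ∨ p = 2 := by omega
  all_goals omega

end LengthCounting

section Model

variable {b m : ℕ} {F F' : Finset (Fin b)} {a a' : ℕ}

/-- The sequence over `C₂ᵇ ⊕ C_m` with the basis elements indexed by `F`, the generator
`(0, 1)` of `C_m` with multiplicity `a`, and the sum of all basis elements with
multiplicity `d`. -/
def modelSeq (m : ℕ) (F : Finset (Fin b)) (a d : ℕ) : Multiset ((Fin b → ZMod 2) × ZMod m) :=
  F.val.map (modelBasis b m) + Multiset.replicate a (0, 1) + Multiset.replicate d ((fun _ ↦ 1), 1)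

/-- The minimal zero-sum sequence of length `b + m` over `C₂ᵇ ⊕ C_m` whose set of lengths, after
concatenation with its negative, is compared with the sets of lengths over other groups. -/
def modelAtom (b m : ℕ) : Multiset ((Fin b → ZMod 2) × ZMod m) :=
  modelSeq m Finset.univ (m - 1) 1

lemma modelBasis_injective : Function.Injective (modelBasis b m) := by
  intro i j h
  by_contra hij
  simpa [modelBasis, hij] using congrFun (congrArg Prod.fst h) i

lemma card_modelSeq (d : ℕ) : (modelSeq m F a d).card = F.card + a + d := by
  simp [modelSeq]

lemma sum_modelSeq (d : ℕ) :
    (modelSeq m F a d).sum =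
      ((fun j ↦ (if j ∈ F then 1 else 0) + (d : ZMod 2)), (a + d : ZMod m)) := by
  have hF : (F.val.map (modelBasis b m)).sum = ((fun j ↦ if j ∈ F then 1 else 0), 0) := by
    change ∑ i ∈ F, modelBasis b m i = _
    ext j
    · simp [modelBasis, Prod.fst_sum, Pi.single_apply]
    · simp [modelBasis, Prod.snd_sum]
  rw [modelSeq, Multiset.sum_add, Multiset.sum_add, hF]
  ext j <;> simp

lemma sum_modelSeq_one : (modelSeq m F a 1).sum = (modelSeq m Fᶜ (a + 1) 0).sum := by
  rw [sum_modelSeq, sum_modelSeq]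
  ext j
  · by_cases hj : j ∈ F
    · simpa [hj] using (by decide : (1 + 1 : ZMod 2) = 0)
    · simp [hj]
  · simp

lemma sum_modelSeq_eq_iff (d : ℕ) :
    (modelSeq m F a d).sum = (modelSeq m F' a' d).sum ↔ F = F' ∧ a ≡ a' [MOD m] := by
  rw [sum_modelSeq, sum_modelSeq, Prod.mk.injEq, add_left_inj, ZMod.natCast_eq_natCast_iff,
    funext_iff, Finset.ext_iff]
  refine and_congr_left' (forall_congr' fun j ↦ ?_)
  by_cases hj : j ∈ F <;> by_cases hj' : j ∈ F' <;> simp [hj, hj']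

lemma exists_eq_modelSeq_of_le {d : ℕ} {T : Multiset ((Fin b → ZMod 2) × ZMod m)}
    (h : T ≤ modelSeq m F a d) : ∃ F', ∃ a' ≤ a, ∃ d' ≤ d, T = modelSeq m F' a' d' := by
  obtain ⟨A, hA, D, hD, rfl⟩ := exists_add_eq_of_le_add h
  obtain ⟨E, hE, Q, hQ, rfl⟩ := exists_add_eq_of_le_add hA
  obtain ⟨a', ha', rfl⟩ := Multiset.le_replicate_iff.mp hQ
  obtain ⟨d', hd', rfl⟩ := Multiset.le_replicate_iff.mp hD
  obtain ⟨F', hF', rfl⟩ := exists_le_map_eq hE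
  exact ⟨⟨F', Multiset.nodup_of_le hF' F.nodup⟩, a', ha', d', hd', rfl⟩

lemma isMinZeroSum_modelAtom (hm : 2 ≤ m) : IsMinZeroSum (modelAtom b m) where
  ne_zero h := by simpa [modelAtom, card_modelSeq] using congrArg Multiset.card h
  sum_eq_zero := by
    have h : (modelSeq m (∅ : Finset (Fin b)) m 0).sum = 0 := by simp [sum_modelSeq, Pi.zero_def]
    rwa [modelAtom, sum_modelSeq_one, Finset.compl_univ, Nat.sub_add_cancel (by omega)]
  eq_of_le T hT hT0 hne := by
    obtain ⟨F, a, ha, d, hd, rfl⟩ := exists_eq_modelSeq_of_le hT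
    have h0 : (0 : (Fin b → ZMod 2) × ZMod m) = (modelSeq m ∅ 0 0).sum := by simp [modelSeq]
    interval_cases d
    · rw [h0, sum_modelSeq_eq_iff, Nat.modEq_zero_iff_dvd] at hT0
      have ha0 := Nat.eq_zero_of_dvd_of_lt hT0.2 (by omega)
      exact absurd (by simp [hT0.1, ha0, modelSeq]) hne
    · rw [h0, sum_modelSeq_one, sum_modelSeq_eq_iff, Nat.modEq_zero_iff_dvd] at hT0
      have hma := Nat.le_of_dvd (by omega) hT0.2
      rw [(Finset.compl_eq_empty_iff _).mp hT0.1, modelAtom, show a = m - 1 by omega]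

lemma count_modelSeq (hm : 2 ≤ m) (d : ℕ) (i : Fin b) :
    (modelSeq m F a d).count (modelBasis b m i) = if i ∈ F then 1 else 0 := by
  have : Fact (1 < m) := ⟨by omega⟩
  have hne : ∀ v : Fin b → ZMod 2, (v, (1 : ZMod m)) ≠ modelBasis b m i := fun v h ↦
    one_ne_zero (congrArg Prod.snd h)
  rw [modelSeq, Multiset.count_add, Multiset.count_add, Multiset.count_replicate,
    Multiset.count_replicate, if_neg (hne _), if_neg (hne _),
    Multiset.count_map_eq_count' _ _ modelBasis_injective, Multiset.count_eq_of_nodup F.nodup]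
  simp

lemma neg_modelBasis (i : Fin b) : -modelBasis b m i = modelBasis b m i :=
  neg_eq_of_add_eq_zero_left (modelBasis_add_self i)

lemma count_modelSeq_add_negSeq_compl (hm : 2 ≤ m) (i : Fin b) :
    (modelSeq m F a 1 + negSeq (modelSeq m Fᶜ a' 0)).count (modelBasis b m i) = 1 := by
  rw [Multiset.count_add, count_negSeq, neg_modelBasis, count_modelSeq hm,
    count_modelSeq hm]
  by_cases hi : i ∈ F <;> simp [hi]

lemma modelSeq_add_negSeq_compl (d : ℕ) :
    modelSeq m F a d + negSeq (modelSeq m Fᶜ 0 0) = modelSeq m Finset.univ a d := by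
  have hneg : negSeq (modelSeq m Fᶜ 0 0) = Fᶜ.val.map (modelBasis b m) := by
    simp [modelSeq, negSeq, neg_modelBasis]
  have hF : (Finset.univ : Finset (Fin b)).val = F.val + Fᶜ.val := by
    rw [← F.disjUnion_val Fᶜ disjoint_compl_right, Finset.disjUnion_eq_union,
      Finset.union_compl]
  rw [hneg, modelSeq, modelSeq, hF, Multiset.map_add]
  abel

lemma IsSumRelation.eq_compl_and_eq (hm : 3 ≤ m) (ha : a ≤ m - 1) (ha' : a' ≤ m - 1)
    (h : IsSumRelation (modelAtom b m) (modelSeq m F a 1) (modelSeq m F' a' 0)) :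
    F' = Fᶜ ∧ (a = m - 1 ∧ a' = 0 ∨ a = 0 ∧ a' = 1) := by
  have hzero : a = 0 ∨ a' = 0 := by
    by_contra! hne
    have hdisj := h.disjoint
    rw [Multiset.disjoint_left] at hdisj
    refine hdisj (a := (0, 1)) ?_ ?_ <;>
      simp [modelSeq, Multiset.mem_replicate, hne.1, hne.2]
  obtain ⟨hF, hmod⟩ := (sum_modelSeq_eq_iff 0).mp (sum_modelSeq_one.symm.trans h.sum_eq)
  refine ⟨hF.symm, ?_⟩
  rcases hzero with rfl | rfl
  · exact .inr ⟨rfl, (hmod.eq_of_lt_of_lt (by omega) (by omega)).symm⟩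
  · have := Nat.le_of_dvd (by omega) (Nat.modEq_zero_iff_dvd.mp hmod)
    omega

lemma IsSumRelation.eq_modelAtom_or_card_eq (hm : 3 ≤ m) (i : Fin b) (ha : a ≤ m - 1)
    (ha' : a' ≤ m - 1)
    (h : IsSumRelation (modelAtom b m) (modelSeq m F a 1) (modelSeq m F' a' 0)) :
    modelSeq m F a 1 + negSeq (modelSeq m F' a' 0) = modelAtom b m ∨
      (modelSeq m F a 1 + negSeq (modelSeq m F' a' 0)).card = b + 2 ∧
        (modelSeq m F a 1 + negSeq (modelSeq m F' a' 0)).count (modelBasis b m i) = 1 := by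
  obtain ⟨rfl, ⟨rfl, rfl⟩ | ⟨rfl, rfl⟩⟩ := h.eq_compl_and_eq hm ha ha'
  · exact .inl (modelSeq_add_negSeq_compl 1)
  · refine .inr ⟨?_, count_modelSeq_add_negSeq_compl (by omega) i⟩
    have hF := F.card_add_card_compl
    rw [Fintype.card_fin] at hF
    rw [Multiset.card_add, card_negSeq, card_modelSeq, card_modelSeq]
    omega

lemma card_eq_or_eq_of_le_modelAtom_add_negSeq (hm : 3 ≤ m) (i : Fin b)
    {W : Multiset ((Fin b → ZMod 2) × ZMod m)} (hle : W ≤ modelAtom b m + negSeq (modelAtom b m))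
    (hW : IsMinZeroSum W) :
    W.card = 2 ∨ W = modelAtom b m ∨ W = negSeq (modelAtom b m) ∨
      W.card = b + 2 ∧ W.count (modelBasis b m i) = 1 := by
  obtain h2 | ⟨A, B, h, rfl⟩ := hW.card_eq_two_or_exists_isSumRelation hle
  · exact .inl h2
  right
  obtain ⟨F, a, ha, d, hd, rfl⟩ := exists_eq_modelSeq_of_le h.left_le
  obtain ⟨F', a', ha', d', hd', rfl⟩ := exists_eq_modelSeq_of_le h.right_le
  have hdd : d ≠ d' := by
    rintro rfl
    obtain ⟨rfl, hmod⟩ := (sum_modelSeq_eq_iff d).mp h.sum_eq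
    exact h.ne (by rw [hmod.eq_of_lt_of_lt (by omega) (by omega)])
  obtain ⟨rfl, rfl⟩ | ⟨rfl, rfl⟩ : d = 1 ∧ d' = 0 ∨ d = 0 ∧ d' = 1 := by omega
  · exact (h.eq_modelAtom_or_card_eq hm i ha ha').imp_right .inr
  · right
    have hneg : modelSeq m F a 0 + negSeq (modelSeq m F' a' 1) =
        negSeq (modelSeq m F' a' 1 + negSeq (modelSeq m F a 0)) := by
      rw [negSeq_add, negSeq_negSeq, add_comm]
    rw [hneg, card_negSeq, count_negSeq, neg_modelBasis]
    exact (h.symm.eq_modelAtom_or_card_eq hm i ha' ha).imp_left (congrArg negSeq)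

lemma card_modelAtom (hm : 1 ≤ m) : (modelAtom b m).card = b + m := by
  rw [modelAtom, card_modelSeq, Finset.card_univ, Fintype.card_fin]
  omega

lemma eq_of_mem_lengthSet_modelAtom (hb : 1 ≤ b) (hm : 3 ≤ m) {k : ℕ}
    (hk : k ∈ lengthSet (modelAtom b m + negSeq (modelAtom b m))) :
    k = 2 ∨ k = m ∨ k = b + m := by
  let i : Fin b := ⟨0, hb⟩
  have h := (isMinZeroSum_modelAtom (by omega)).eq_of_mem_lengthSet_add_negSeq
    (modelBasis_add_self i) (by rw [modelAtom, count_modelSeq (by omega)]; simp)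
    (fun W hle hW ↦ card_eq_or_eq_of_le_modelAtom_add_negSeq hm i hle hW) hk
  rw [card_modelAtom (by omega)] at h
  omega

lemma isSumRelation_modelAtom (hb : 1 ≤ b) (hm : 2 ≤ m) :
    IsSumRelation (modelAtom b m) (modelSeq m Finset.univ 0 1) {(0, 1)} where
  left_le := by
    refine add_le_add (add_le_add le_rfl ?_) le_rfl
    simp
  right_le := by
    rw [Multiset.singleton_le, modelAtom, modelSeq]
    simp only [Multiset.mem_add, Multiset.mem_replicate]
    exact .inl (.inr ⟨by omega, trivial⟩)
  disjoint := by
    have : Fact (1 < m) := ⟨by omega⟩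
    rw [Multiset.disjoint_singleton, modelSeq]
    simp only [Multiset.mem_add, Multiset.mem_replicate, Multiset.mem_map]
    rintro ((⟨j, -, hj⟩ | h) | h)
    · exact zero_ne_one (congrArg Prod.snd hj)
    · exact h.1 rfl
    · exact zero_ne_one (congrFun (congrArg Prod.fst h.2) ⟨0, hb⟩)
  sum_eq := by
    rw [sum_modelSeq_one, Finset.compl_univ]
    simp [modelSeq]
  ne h := by simpa [card_modelSeq, show b ≠ 0 by omega] using congrArg Multiset.card h

theorem lengthSet_modelAtom_add_negSeq (hb : 1 ≤ b) (hm : 3 ≤ m) :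
    lengthSet (modelAtom b m + negSeq (modelAtom b m)) = {2, m, b + m} := by
  have hU := isMinZeroSum_modelAtom (b := b) (m := m) (by omega)
  have hc := card_modelAtom (b := b) (m := m) (by omega)
  refine Set.Subset.antisymm (fun k hk ↦ eq_of_mem_lengthSet_modelAtom hb hm hk) ?_
  rintro k (rfl | rfl | rfl)
  · exact hU.two_mem_lengthSet hU.neg
  · obtain ⟨p, hp, hp3, l, hlL, hl⟩ :=
      (isSumRelation_modelAtom hb (by omega)).exists_mem_lengthSet hU (by omega)
    have hl' := eq_of_mem_lengthSet_modelAtom hb hm hlL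
    rw [hc, card_modelSeq, Multiset.card_singleton, Finset.card_univ, Fintype.card_fin] at hl
    rw [card_modelSeq, Multiset.card_singleton, Finset.card_univ, Fintype.card_fin] at hp3
    rwa [show l = k by omega] at hlL
  · exact hc ▸ card_mem_lengthSet (hU.zero_notMem (by omega))

end Model


section Transfer

variable {G H : Type*} [AddCommGroup G] [AddCommGroup H]

lemma DavenportLE.of_groupLengthSystem_eq {D : ℕ} (hH : DavenportLE H D) (hD : 2 ≤ D)
    (hGH : groupLengthSystem G = groupLengthSystem H) : DavenportLE G D := by
  intro W hW
  by_contra! hlt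
  have hmem : lengthSet (W + negSeq W) ∈ groupLengthSystem H := by
    rw [← hGH, mem_groupLengthSystem_iff]
    exact ⟨_, by simp, rfl⟩
  obtain ⟨S, -, hS⟩ := (mem_groupLengthSystem_iff _).mp hmem
  have := hH.le_of_two_mem_lengthSet hD (hS ▸ hW.two_mem_lengthSet hW.neg)
    (hS ▸ card_mem_lengthSet (hW.zero_notMem (by omega)))
  omega

lemma DavenportLE.exists_isLongestMinZeroSum {b m : ℕ} (hG : DavenportLE G (b + m)) (hb : 1 ≤ b)
    (hm : 3 ≤ m) (hL : groupLengthSystem G = groupLengthSystem ((Fin b → ZMod 2) × ZMod m)) :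
    ∃ U : Multiset G, IsLongestMinZeroSum U ∧ U.card = b + m ∧
      lengthSet (U + negSeq U) = {2, m, b + m} := by
  have hmem : ({2, m, b + m} : Set ℕ) ∈ groupLengthSystem G := by
    rw [hL, mem_groupLengthSystem_iff]
    exact ⟨_, by simp, lengthSet_modelAtom_add_negSeq hb hm⟩
  obtain ⟨S, -, hS⟩ := (mem_groupLengthSystem_iff _).mp hmem
  obtain ⟨U, hU, hc, rfl⟩ := hG.exists_eq_add_negSeq (S := S) (by omega)
    (by rw [hS]; simp) (by rw [hS]; simp)
  exact ⟨U, hU, hc, hS⟩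

lemma nonempty_addEquiv_fin_one_prod (m : ℕ) :
    Nonempty ((Fin 1 → ZMod 2) × ZMod m ≃+ ZMod 2 × ZMod m) :=
  ⟨AddEquiv.prodCongr (AddEquiv.piUnique fun _ : Fin 1 ↦ ZMod 2) (AddEquiv.refl _)⟩

theorem nonempty_addEquiv_zmod_two_prod_zmod {n : ℕ} (hn : 2 ≤ n)
    (hL : groupLengthSystem G = groupLengthSystem (ZMod 2 × ZMod (2 * n))) :
    Nonempty (G ≃+ ZMod 2 × ZMod (2 * n)) := by
  have hG : DavenportLE G (1 + 2 * n) := by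
    rw [add_comm]
    exact (davenportLE_zmod_two_prod_zmod (by omega)).of_groupLengthSystem_eq (by omega) hL
  obtain ⟨e⟩ := nonempty_addEquiv_fin_one_prod (2 * n)
  obtain ⟨U, hU, hc, hLU⟩ := hG.exists_isLongestMinZeroSum le_rfl (by omega)
    (hL.trans (groupLengthSystem_congr e).symm)
  have hn' : U.card - 1 = 2 * n := by omega
  rw [← hn']
  exact hU.nonempty_addEquiv_zmod_two_prod (by omega) (by rw [hLU, hn', hc])

theorem nonempty_addEquiv_pi_zmod_two_prod_zmod_four {b : ℕ} (hb : 2 ≤ b)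
    (hL : groupLengthSystem G = groupLengthSystem ((Fin b → ZMod 2) × ZMod 4)) :
    Nonempty (G ≃+ (Fin b → ZMod 2) × ZMod 4) := by
  have hG : DavenportLE G (b + 4) :=
    (davenportLE_pi_zmod_two_prod_zmod_four b).of_groupLengthSystem_eq (by omega) hL
  obtain ⟨U, hU, hc, hLU⟩ := hG.exists_isLongestMinZeroSum (by omega) (by norm_num) hL
  obtain ⟨q, hq, hq4, hq2⟩ := hU.exists_two_nsmul (by omega) (by rw [hLU, hc])
  have := hU.finite
  obtain ⟨c, ⟨f⟩⟩ := exists_addEquiv_pi_zmod_two_prod_zmod_four hq hq4 hq2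
  have hbc := davenportLE_pi_zmod_two_prod_zmod_four c _ (hU.map f)
  have hcb := hG _ ((isMinZeroSum_modelAtom (b := c) (m := 4) (by norm_num)).map f.symm)
  rw [Multiset.card_map, hc] at hbc
  rw [Multiset.card_map, card_modelAtom (by norm_num)] at hcb
  obtain rfl : c = b := by omega
  exact ⟨f⟩

end Transfer

end SetsOfLengths

theorem corollary1p3 {G : Type*} [AddCommGroup G] :
    (∀ r : ℕ, 2 ≤ r →
      SetsOfLengths.groupLengthSystem G =
        SetsOfLengths.groupLengthSystem ((Fin (r - 1) → ZMod 2) × ZMod 4) →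
      Nonempty (G ≃+ (Fin (r - 1) → ZMod 2) × ZMod 4)) ∧
    (∀ n : ℕ, 2 ≤ n →
      SetsOfLengths.groupLengthSystem G =
        SetsOfLengths.groupLengthSystem (ZMod 2 × ZMod (2 * n)) →
      Nonempty (G ≃+ ZMod 2 × ZMod (2 * n))) := by
  refine ⟨fun r hr hL ↦ ?_, fun n hn hL ↦
    SetsOfLengths.nonempty_addEquiv_zmod_two_prod_zmod hn hL⟩
  rcases hr.eq_or_lt with rfl | hr
  · obtain ⟨e⟩ := SetsOfLengths.nonempty_addEquiv_fin_one_prod 4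
    obtain ⟨f⟩ := SetsOfLengths.nonempty_addEquiv_zmod_two_prod_zmod le_rfl
      (hL.trans (SetsOfLengths.groupLengthSystem_congr e))
    exact ⟨f.trans e.symm⟩
  · exact SetsOfLengths.nonempty_addEquiv_pi_zmod_two_prod_zmod_four (by omega) hL
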